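/- Let $(X,d)$ be a metric space in which every ball $B(x,r)=\{y : d(x,y)<r\}$ has compact closure, and let $\mu$ be a Radon measure on $X$ with full support that is Ahlfors $d_H$-regular for some $d_H>0$: there are $c_1,c_2>0$ with $c_1r^{d_H}\le\mu(B(x,r))\le c_2r^{d_H}$ for all $x\in X$, $r\ge 0$. Let $(\mathcal E,\mathcal F)$ be a regular, strongly local Dirichlet form on $L^2(X,\mu)$ with associated heat semigroup $\{P_t\}_{t>0}$ (the strongly continuous contraction semigroup generated by the operator $L$ of the form). Let $d_W\ge 2$ and assume that $P_t$ has a heat kernel $p_t(x,y)$, continuous in $(x,y)$ for each $t>0$, such that for some $c_3,c_4,c_5,c_6>0$, every $t>0$ and $\mu\times\mu$-a.e. $(x,y)$, $$c_5t^{-d_H/d_W}\exp\Bigl(-c_6\bigl(\tfrac{d(x,y)^{d_W}}{t}\bigr)^{\frac1{d_W-1}}\Bigr)\le p_t(x,y)\le c_3t^{-d_H/d_W}\exp\Bigl(-c_4\bigl(\tfrac{d(x,y)^{d_W}}{t}\bigr)^{\frac1{d_W-1}}\Bigr).$$ For $\lambda>0$ let $KS^{\lambda,1}(X)$ be the set of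 $f\in L^1(X,\mu)$ with $$\limsup_{r\to0^+}\int_X\int_{B(x,r)}\frac{|f(x)-f(y)|}{r^{\lambda}\mu(B(x,r))}\,d\mu(y)\,d\mu(x)<\infty .$$ Assume the weak Bakry–Émery estimate: for the exponent $0<\kappa<d_W$ defined by $d_W-\kappa=\sup\{\lambda>0 : KS^{\lambda,1}(X)\text{ contains non-constant functions}\}$ there is $C>0$ such that for all $t>0$, $g\in L^\infty(X,\mu)$ and $x,y\in X$, $$|P_tg(x)-P_tg(y)|\le C\,\frac{d(x,y)^\kappa}{t^{\kappa/d_W}}\,\|g\|_{L^\infty(X,\mu)},\qquad P_tg(x)=\int_X p_t(x,z)g(z)\,d\mu(z).$$ Let $0<\delta<1$, and for $t>0$ let $\eta_t^{(\delta)}$ be the non-negative continuous function on $(0,\infty)$ with $\int_0^\infty\eta^{(\delta)}_t(s)e^{-s\lambda}\,ds=e^{-t\lambda^\delta}$ for all $\lambda>0$. Let $P_t^{(\delta)}f=\int_0^\infty\eta_t^{(\delta)}(s)P_sf\,ds$ be the semigroup of the fractional Laplacian $(-L)^\delta$, and $p^{(\delta)}_t(x,y)$ its heat kernel. For $\alpha>0$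 let $\mathbf B^{1,\alpha}(X)$ be the set of $f\in L^1(X,\mu)$ with $$\sup_{t>0}t^{-\alpha}\int_X\int_X|f(x)-f(y)|\,p^{(\delta)}_t(x,y)\,d\mu(x)\,d\mu(y)<\infty ,$$ and let $$\alpha_1^{\#}=\sup\{\alpha>0 : \mathbf B^{1,\alpha}(X)\text{ contains non-constant functions}\}.$$ Then: (i) if $\delta\le 1-\frac{\kappa}{d_W}$, then $\alpha_1^{\#}=1$; (ii) if $\delta>1-\frac{\kappa}{d_W}$, then $\alpha_1^{\#}=\frac1\delta\bigl(1-\frac{\kappa}{d_W}\bigr)$. (Functions are identified when equal almost everywhere; "non-constant" means not a.e. equal to a constant.) -/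

import Mathlib

open MeasureTheory Filter Topology Set
open scoped ENNReal

namespace NonlocalBV

/-- A Dirichlet form on `L²(X, μ)`: a densely defined, closed, symmetric, nonnegative bilinear form
on which the unit contraction operates. -/
structure DirichletForm {X : Type*} [MeasurableSpace X] (μ : Measure X) where
  /-- The domain `𝓕`. -/
  domain : Submodule ℝ (Lp ℝ 2 μ)
  /-- The bilinear form `𝓔` on `𝓕`. -/
  form : domain →ₗ[ℝ] domain →ₗ[ℝ] ℝ
  dense_domain : Dense (domain : Set (Lp ℝ 2 μ))
  symm : ∀ u v : domain, form u v = form v u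
  nonneg : ∀ u : domain, 0 ≤ form u u
  /-- Closedness: `𝓕` is complete for the norm `(‖u‖² + 𝓔(u, u))^{1/2}`. -/
  closed : ∀ u : ℕ → domain,
    (∀ ε : ℝ, 0 < ε → ∃ N : ℕ, ∀ m n : ℕ, N ≤ m → N ≤ n →
      ‖(u m : Lp ℝ 2 μ) - (u n : Lp ℝ 2 μ)‖ ^ 2 + form (u m - u n) (u m - u n) < ε) →
    ∃ v : domain, Tendsto
      (fun n => ‖(u n : Lp ℝ 2 μ) - (v : Lp ℝ 2 μ)‖ ^ 2 + form (u n - v) (u n - v)) atTop (𝓝 0)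
  /-- The Markov property. -/
  markov : ∀ u : domain, ∃ v : domain,
    ((v : Lp ℝ 2 μ) : X → ℝ) =ᵐ[μ] (fun x => min (max ((u : Lp ℝ 2 μ) x) 0) 1) ∧
      form v v ≤ form u u

/-- `C` is a core of the form: a set of continuous compactly supported functions in the domain,
uniformly dense in `C_c(X)` and dense in the domain for the norm `(‖u‖² + 𝓔(u, u))^{1/2}`. -/
def DirichletForm.IsCore {X : Type*} [TopologicalSpace X] [MeasurableSpace X] {μ : Measure X}
    (E : DirichletForm μ) (C : Set (X → ℝ)) : Prop :=
  (∀ φ ∈ C, Continuous φ ∧ HasCompactSupport φ ∧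
    ∃ u : E.domain, ((u : Lp ℝ 2 μ) : X → ℝ) =ᵐ[μ] φ) ∧
  (∀ g : X → ℝ, Continuous g → HasCompactSupport g → ∀ ε : ℝ, 0 < ε →
    ∃ φ ∈ C, ∀ x, |g x - φ x| < ε) ∧
  (∀ u : E.domain, ∀ ε : ℝ, 0 < ε → ∃ φ ∈ C, ∃ v : E.domain,
    ((v : Lp ℝ 2 μ) : X → ℝ) =ᵐ[μ] φ ∧
      ‖(u : Lp ℝ 2 μ) - (v : Lp ℝ 2 μ)‖ ^ 2 + E.form (u - v) (u - v) < ε)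

/-- A Dirichlet form is regular if it admits a core. -/
def DirichletForm.IsRegular {X : Type*} [TopologicalSpace X] [MeasurableSpace X] {μ : Measure X}
    (E : DirichletForm μ) : Prop :=
  ∃ C : Set (X → ℝ), E.IsCore C

/-- The support of (the a.e.-class of) `f`: the complement of the largest open set on which `f`
vanishes almost everywhere. -/
def essSupport {X : Type*} [TopologicalSpace X] [MeasurableSpace X] (μ : Measure X)
    (f : X → ℝ) : Set X :=
  {x | ∀ U ∈ 𝓝 x, ¬ (f =ᵐ[μ.restrict U] 0)}

/-- Strong locality: `𝓔(f, g) = 0` whenever `f, g ∈ 𝓕` have compact supports and `f` is constant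
in a neighbourhood of the support of `g`. -/
def DirichletForm.IsStronglyLocal {X : Type*} [TopologicalSpace X] [MeasurableSpace X]
    {μ : Measure X} (E : DirichletForm μ) : Prop :=
  ∀ f g : E.domain, IsCompact (essSupport μ (f : Lp ℝ 2 μ)) →
    IsCompact (essSupport μ (g : Lp ℝ 2 μ)) →
    (∃ U : Set X, IsOpen U ∧ essSupport μ (g : Lp ℝ 2 μ) ⊆ U ∧
      ∃ c : ℝ, ((f : Lp ℝ 2 μ) : X → ℝ) =ᵐ[μ.restrict U] fun _ => c) →
    E.form f g = 0

/-- `P = (P_t)_{t > 0}` is the heat semigroup on `L²(X, μ)` associated with the Dirichlet form: the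
strongly continuous contraction semigroup whose infinitesimal generator is the operator `L`
associated with the form, i.e. `f ∈ dom L` and `L f = h` iff `f ∈ 𝓕` and `𝓔(f, v) = -⟨h, v⟩` for all
`v ∈ 𝓕`. (Such a `P` is unique; only its values at `t > 0` matter.) -/
structure DirichletForm.IsHeatSemigroup {X : Type*} [MeasurableSpace X] {μ : Measure X}
    (E : DirichletForm μ) (P : ℝ → Lp ℝ 2 μ →L[ℝ] Lp ℝ 2 μ) : Prop where
  semigroup : ∀ s t : ℝ, 0 < s → 0 < t → P (s + t) = (P s).comp (P t)
  contraction : ∀ t : ℝ, 0 < t → ‖P t‖ ≤ 1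
  strongly_continuous : ∀ f : Lp ℝ 2 μ, Tendsto (fun t => P t f) (𝓝[>] 0) (𝓝 f)
  generator : ∀ f h : Lp ℝ 2 μ,
    Tendsto (fun t : ℝ => t⁻¹ • (P t f - f)) (𝓝[>] 0) (𝓝 h) ↔
      ∃ hf : f ∈ E.domain, ∀ v : E.domain, E.form ⟨f, hf⟩ v = - inner ℝ h (v : Lp ℝ 2 μ)

/-- `p_t(x, y)` is a (nonnegative, measurable) heat kernel of the family `(T_t)_{t > 0}` of operators
on `L²(X, μ)`: `T_t f (x) = ∫ p_t(x, y) f(y) dμ(y)` for a.e. `x`. -/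
structure IsHeatKernel {X : Type*} [MeasurableSpace X] {μ : Measure X}
    (T : ℝ → Lp ℝ 2 μ → Lp ℝ 2 μ) (p : ℝ → X → X → ℝ) : Prop where
  measurable : ∀ t : ℝ, 0 < t → Measurable (Function.uncurry (p t))
  nonneg : ∀ t : ℝ, 0 < t → ∀ x y, 0 ≤ p t x y
  integrable : ∀ t : ℝ, 0 < t → ∀ f : Lp ℝ 2 μ, ∀ᵐ x ∂μ, Integrable (fun y => p t x y * f y) μ
  repr : ∀ t : ℝ, 0 < t → ∀ f : Lp ℝ 2 μ,
    (T t f : X → ℝ) =ᵐ[μ] fun x => ∫ y, p t x y * f y ∂μ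

/-- Ahlfors `d_H`-regularity. -/
def IsAhlforsRegular {X : Type*} [MetricSpace X] [MeasurableSpace X] (μ : Measure X)
    (dH : ℝ) : Prop :=
  ∃ c₁ c₂ : ℝ, 0 < c₁ ∧ 0 < c₂ ∧ ∀ (x : X) (r : ℝ), 0 ≤ r →
    ENNReal.ofReal (c₁ * r ^ dH) ≤ μ (Metric.ball x r) ∧
      μ (Metric.ball x r) ≤ ENNReal.ofReal (c₂ * r ^ dH)

/-- Two-sided sub-Gaussian estimates for the kernel `p_t(x, y)`. -/
def HasSubGaussianEstimates {X : Type*} [MetricSpace X] [MeasurableSpace X] (μ : Measure X)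
    (dH dW : ℝ) (p : ℝ → X → X → ℝ) : Prop :=
  ∃ c₃ c₄ c₅ c₆ : ℝ, 0 < c₃ ∧ 0 < c₄ ∧ 0 < c₅ ∧ 0 < c₆ ∧
    ∀ t : ℝ, 0 < t → ∀ᵐ z : X × X ∂(μ.prod μ),
      c₅ * t ^ (-dH / dW) * Real.exp (-c₆ * (dist z.1 z.2 ^ dW / t) ^ (1 / (dW - 1)))
          ≤ p t z.1 z.2 ∧
        p t z.1 z.2 ≤
          c₃ * t ^ (-dH / dW) * Real.exp (-c₄ * (dist z.1 z.2 ^ dW / t) ^ (1 / (dW - 1)))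

/-- `f` is (a.e. equal to) a constant. -/
def IsConstant {X : Type*} [MeasurableSpace X] (μ : Measure X) (f : X → ℝ) : Prop :=
  ∃ c : ℝ, f =ᵐ[μ] fun _ => c

/-- The `p`-th power of the Korevaar–Schoen seminorm,
`limsup_{r → 0+} ∫_X ∫_{B(x,r)} |f(x) - f(y)|^p / (r^{lam p} μ(B(x,r))) dμ(y) dμ(x)`. -/
noncomputable def ksSeminormPow {X : Type*} [MetricSpace X] [MeasurableSpace X] (μ : Measure X)
    (lam p : ℝ) (f : X → ℝ) : ℝ≥0∞ :=
  limsup (fun r : ℝ => ∫⁻ x, ∫⁻ y in Metric.ball x r,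
    ENNReal.ofReal (|f x - f y| ^ p) / (ENNReal.ofReal (r ^ (lam * p)) * μ (Metric.ball x r))
      ∂μ ∂μ) (𝓝[>] 0)

/-- The Korevaar–Schoen space `KS^{lam, p}(X)`. -/
def ksSpace {X : Type*} [MetricSpace X] [MeasurableSpace X] (μ : Measure X)
    (lam p : ℝ) : Set (X → ℝ) :=
  {f | MemLp f (ENNReal.ofReal p) μ ∧ ksSeminormPow μ lam p f < ∞}

/-- The set of `lam > 0` such that `KS^{lam, 1}(X)` contains non-constant functions. -/
def ksExponents {X : Type*} [MetricSpace X] [MeasurableSpace X] (μ : Measure X) : Set ℝ :=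
  {lam | 0 < lam ∧ ∃ f ∈ ksSpace μ lam 1, ¬ IsConstant μ f}

/-- The weak Bakry–Émery estimate with exponent `κ`, where `κ` is the critical exponent given by
`d_W - κ = sup {lam > 0 : KS^{lam, 1}(X) contains non-constant functions}`. On `L^∞` the semigroup
acts through its heat kernel, `P_t g (x) = ∫ p_t(x, y) g(y) dμ(y)`. -/
structure WeakBakryEmery {X : Type*} [MetricSpace X] [MeasurableSpace X] (μ : Measure X)
    (dW κ : ℝ) (p : ℝ → X → X → ℝ) : Prop where
  estimate : ∃ C : ℝ, 0 < C ∧ ∀ t : ℝ, 0 < t → ∀ g : Lp ℝ ∞ μ, ∀ x y : X,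
    |(∫ z, p t x z * g z ∂μ) - ∫ z, p t y z * g z ∂μ|
      ≤ C * (dist x y ^ κ / t ^ (κ / dW)) * ‖g‖
  critical : IsLUB (ksExponents μ) (dW - κ)

/-- `η_t(s)` is the density of the `δ`-stable subordinator: the nonnegative continuous function of
`s > 0` with Laplace transform `∫_0^∞ η_t(s) e^{-s lam} ds = e^{-t lam^δ}` for all `lam > 0`.
(These properties determine `η_t` on `(0, ∞)`.) -/
structure IsSubordinatorDensity (δ : ℝ) (η : ℝ → ℝ → ℝ) : Prop where
  continuousOn : ∀ t : ℝ, 0 < t → ContinuousOn (η t) (Ioi 0)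
  nonneg : ∀ t : ℝ, 0 < t → ∀ s : ℝ, 0 < s → 0 ≤ η t s
  integrableOn : ∀ t : ℝ, 0 < t → ∀ lam : ℝ, 0 < lam →
    IntegrableOn (fun s => η t s * Real.exp (-s * lam)) (Ioi 0)
  laplace : ∀ t : ℝ, 0 < t → ∀ lam : ℝ, 0 < lam →
    ∫ s in Ioi (0 : ℝ), η t s * Real.exp (-s * lam) = Real.exp (-t * lam ^ δ)

/-- The subordinated semigroup `P^{(δ)}_t f = ∫_0^∞ η_t(s) P_s f ds` (generated by `-(-L)^δ` when
`η` is the density of the `δ`-stable subordinator), as an integral in `L²(X, μ)`. -/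
noncomputable def subordinate {X : Type*} [MeasurableSpace X] {μ : Measure X} (η : ℝ → ℝ → ℝ)
    (P : ℝ → Lp ℝ 2 μ →L[ℝ] Lp ℝ 2 μ) (t : ℝ) (f : Lp ℝ 2 μ) : Lp ℝ 2 μ :=
  ∫ s in Ioi (0 : ℝ), η t s • P s f

/-- The heat kernel based Besov seminorm
`sup_{t > 0} t^{-α} (∫_X ∫_X |f(x) - f(y)|^p q_t(x, y) dμ(x) dμ(y))^{1/p}`. -/
noncomputable def besovSeminorm {X : Type*} [MeasurableSpace X] (μ : Measure X)
    (q : ℝ → X → X → ℝ) (p α : ℝ) (f : X → ℝ) : ℝ≥0∞ :=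
  ⨆ (t : ℝ) (_ : 0 < t), ENNReal.ofReal (t ^ (-α)) *
    (∫⁻ y, ∫⁻ x, ENNReal.ofReal (|f x - f y| ^ p) * ENNReal.ofReal (q t x y) ∂μ ∂μ) ^ (1 / p)

/-- The heat kernel based Besov space `B^{p, α}(X)`. -/
def besovSpace {X : Type*} [MeasurableSpace X] (μ : Measure X)
    (q : ℝ → X → X → ℝ) (p α : ℝ) : Set (X → ℝ) :=
  {f | MemLp f (ENNReal.ofReal p) μ ∧ besovSeminorm μ q p α f < ∞}

/-- `a` is the `L¹` critical exponent
`α_1^# = sup {α > 0 : B^{1, α}(X) contains non-constant functions}`. -/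
def IsL1CriticalExponent {X : Type*} [MeasurableSpace X] (μ : Measure X)
    (q : ℝ → X → X → ℝ) (a : ℝ) : Prop :=
  IsLUB {α : ℝ | 0 < α ∧ ∃ f ∈ besovSpace μ q 1 α, ¬ IsConstant μ f} a

end NonlocalBV

/-! Write `L = dW - κ` for the Korevaar–Schoen critical exponent and `osc(r)` for the integral of
`|f x - f y|` over pairs at distance less than `r`. The proof shows that the critical exponent is
`min L (δ * dW) / (δ * dW)`; the two cases of the theorem say which term is the minimum.

Everything is expressed through `osc`. By Ahlfors regularity, an `L¹` function lies in `KS^{l,1}`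
exactly when `osc(r) = O(r^(dH + l))` as `r → 0`, and the sub-Gaussian bounds compare `osc(r)` with
the heat energy `∫∫ |f x - f y| p_s` at times `s ≈ r^dW`. The subordinated kernel is almost
everywhere the `η_t`-average of `p_s` (`subordinate_kernel_ae_eq`), so only the stable law `η_t`
remains to be understood, and that only through its Laplace transform.

Lower bound on the exponent: if `osc(r) ≤ C r^(dH + l)` at all scales, the heat energy is at most
`C' s^(l/dW)`. The moment of `η_t` of order `l/dW` is at most a constant times `t^(l/(δ dW))` when
`l/dW < δ` (`moment_le`). Hence every `l` below both `L` and `δ * dW` is reached.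

Upper bound: for `t ≤ r^(δ dW)`, `η_t` gives mass at least of order `t * r^(-δ dW)` to times
comparable to `r^dW` (`le_mass`). A finite Besov seminorm therefore yields `osc(r) ≤ C r^(dH + δ dW)
t^(α - 1)`. Fixing `r` and letting `t → 0` forces `α ≤ 1` for non-constant `f`; taking `t = r^(δ
dW)` puts `f` in `KS^{α δ dW, 1}`, so `α δ dW ≤ L`. -/

namespace NonlocalBV

/-! ### Moments and window mass of the stable subordinator, from its Laplace transform. -/

section Subordinator

variable {δ : ℝ} {η : ℝ → ℝ → ℝ}

/-- The Laplace transform is known only for positive arguments, so the total mass is reached by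
Fatou along `lam = 1 / (n + 1) → 0`. -/
lemma IsSubordinatorDensity.lintegral_le_one (hη : IsSubordinatorDensity δ η)
    {t : ℝ} (ht : 0 < t) : ∫⁻ s in Ioi (0 : ℝ), ENNReal.ofReal (η t s) ≤ 1 := by
  have hmeas : ∀ n : ℕ, AEMeasurable
      (fun s => ENNReal.ofReal (η t s * Real.exp (-s * (1 / ((n : ℝ) + 1)))))
      (volume.restrict (Ioi (0 : ℝ))) := fun n =>
    (hη.integrableOn t ht (1 / ((n : ℝ) + 1))
      (by positivity)).aestronglyMeasurable.aemeasurable.ennreal_ofReal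
  have hlim : ∀ s : ℝ, Tendsto
      (fun n : ℕ => ENNReal.ofReal (η t s * Real.exp (-s * (1 / ((n : ℝ) + 1))))) atTop
      (𝓝 (ENNReal.ofReal (η t s))) := by
    intro s
    apply ENNReal.tendsto_ofReal
    have h1 : Tendsto (fun n : ℕ => -s * (1 / ((n : ℝ) + 1))) atTop (𝓝 (-s * 0)) :=
      tendsto_one_div_add_atTop_nhds_zero_nat.const_mul _
    have h2 := ((Real.continuous_exp.tendsto _).comp h1).const_mul (η t s)
    simpa [Function.comp_def] using h2
  calc ∫⁻ s in Ioi (0 : ℝ), ENNReal.ofReal (η t s)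
      = ∫⁻ s in Ioi (0 : ℝ), liminf (fun n : ℕ =>
          ENNReal.ofReal (η t s * Real.exp (-s * (1 / ((n : ℝ) + 1))))) atTop :=
        lintegral_congr fun s => ((hlim s).liminf_eq).symm
    _ ≤ liminf (fun n : ℕ => ∫⁻ s in Ioi (0 : ℝ),
          ENNReal.ofReal (η t s * Real.exp (-s * (1 / ((n : ℝ) + 1))))) atTop :=
        lintegral_liminf_le' hmeas
    _ ≤ 1 := by
        refine liminf_le_of_le (by isBoundedDefault) fun b hb => ?_
        obtain ⟨n, hn⟩ := hb.exists
        refine hn.trans ?_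
        rw [← ofReal_integral_eq_lintegral_ofReal
          (hη.integrableOn t ht (1 / ((n : ℝ) + 1)) (by positivity)), hη.laplace t ht _ (by positivity)]
        · rw [← ENNReal.ofReal_one]
          apply ENNReal.ofReal_le_ofReal
          rw [Real.exp_le_one_iff]
          have : 0 ≤ t * (1 / ((n : ℝ) + 1)) ^ δ := by positivity
          linarith
        · filter_upwards [ae_restrict_mem measurableSet_Ioi] with s hs
          exact mul_nonneg (hη.nonneg t ht s hs) (Real.exp_pos _).le

lemma IsSubordinatorDensity.integrableOn_self (hη : IsSubordinatorDensity δ η)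
    {t : ℝ} (ht : 0 < t) : IntegrableOn (η t) (Ioi 0) := by
  refine ⟨(hη.continuousOn t ht).aestronglyMeasurable measurableSet_Ioi, ?_⟩
  rw [hasFiniteIntegral_iff_ofReal]
  · exact (hη.lintegral_le_one ht).trans_lt ENNReal.one_lt_top
  · filter_upwards [ae_restrict_mem measurableSet_Ioi] with s hs using hη.nonneg t ht s hs

lemma IsSubordinatorDensity.integral_le_one (hη : IsSubordinatorDensity δ η)
    {t : ℝ} (ht : 0 < t) : ∫ s in Ioi (0 : ℝ), η t s ≤ 1 := by
  rw [integral_eq_lintegral_of_nonneg_ae _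
    (hη.integrableOn_self ht).aestronglyMeasurable]
  · exact ENNReal.toReal_le_of_le_ofReal zero_le_one (by
      simpa using hη.lintegral_le_one ht)
  · filter_upwards [ae_restrict_mem measurableSet_Ioi] with s hs using hη.nonneg t ht s hs

lemma one_sub_exp_neg_le (x : ℝ) : 1 - Real.exp (-x) ≤ x := by
  have := Real.add_one_le_exp (-x)
  linarith

/-- The left side is the total mass minus a Laplace transform, hence at most `1 - exp(-t l^δ)`. Such
test functions serve as building blocks for the moments. -/
lemma IsSubordinatorDensity.lintegral_one_sub_exp_le (hη : IsSubordinatorDensity δ η)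
    {t : ℝ} (ht : 0 < t) {l : ℝ} (hl : 0 < l) :
    ∫⁻ s in Ioi (0 : ℝ), ENNReal.ofReal (η t s * (1 - Real.exp (-s * l)))
      ≤ ENNReal.ofReal (t * l ^ δ) := by
  have h1 := hη.integrableOn_self ht
  have h2 := hη.integrableOn t ht l hl
  have h3 : (fun s => η t s * (1 - Real.exp (-s * l))) =
      fun s => η t s - η t s * Real.exp (-s * l) := by
    ext s; ring
  have h4 : IntegrableOn (fun s => η t s * (1 - Real.exp (-s * l))) (Ioi 0) := by
    rw [h3]; exact h1.sub h2
  rw [← ofReal_integral_eq_lintegral_ofReal h4]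
  · apply ENNReal.ofReal_le_ofReal
    rw [h3, integral_sub h1 h2, hη.laplace t ht l hl]
    have := one_sub_exp_neg_le (t * l ^ δ)
    have h5 := hη.integral_le_one ht
    rw [neg_mul]
    linarith
  · filter_upwards [ae_restrict_mem measurableSet_Ioi] with s hs
    have hs' : (0 : ℝ) < s := hs
    refine mul_nonneg (hη.nonneg t ht s hs) ?_
    have : Real.exp (-s * l) ≤ 1 := Real.exp_le_one_iff.2 (by nlinarith)
    simpa using this

/-- For `x > 1` the single dyadic term with `2^j ≤ x < 2^(j+1)` already dominates, because `1 -
exp(-x / 2^j) ≥ 1 - exp(-1) ≥ 1/2`. This replaces a power by functions whose `η_t`-integral is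
controlled by the Laplace transform. -/
lemma rpow_le_one_add_tsum {γ : ℝ} (hγ : 0 < γ) {x : ℝ} (hx : 0 < x) :
    ENNReal.ofReal (x ^ γ) ≤ 1 + ∑' j : ℕ, ENNReal.ofReal
      (2 * 2 ^ γ * (2 ^ j) ^ γ * (1 - Real.exp (-x / 2 ^ j))) := by
  rcases le_or_gt x 1 with h | h
  · refine le_add_right ?_
    rw [← ENNReal.ofReal_one]
    exact ENNReal.ofReal_le_ofReal (Real.rpow_le_one hx.le h hγ.le)
  · obtain ⟨j, hj1, hj2⟩ := exists_nat_pow_near h.le (one_lt_two : (1 : ℝ) < 2)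
    refine le_add_left (le_trans ?_ (ENNReal.le_tsum j))
    apply ENNReal.ofReal_le_ofReal
    have h1 : x ^ γ ≤ 2 ^ γ * (2 ^ j) ^ γ := by
      rw [← Real.mul_rpow (by norm_num) (by positivity)]
      refine Real.rpow_le_rpow hx.le ?_ hγ.le
      rw [pow_succ] at hj2
      linarith
    have h2 : 1 ≤ 2 * (1 - Real.exp (-x / 2 ^ j)) := by
      have h3 : Real.exp (-x / 2 ^ j) ≤ Real.exp (-1) := by
        apply Real.exp_le_exp.2
        rw [neg_div, neg_le_neg_iff, le_div_iff₀ (by positivity)]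
        linarith
      have h4 : Real.exp (-1) ≤ 1 / 2 := by
        rw [Real.exp_neg, one_div]
        apply inv_anti₀ (by norm_num)
        have := Real.add_one_le_exp (1 : ℝ)
        linarith
      linarith
    have h5 : 0 ≤ (2 : ℝ) ^ γ * (2 ^ j) ^ γ := by positivity
    nlinarith

/-- Moments of order `γ < δ` of the `δ`-stable subordinator. -/
lemma IsSubordinatorDensity.moment_le (hη : IsSubordinatorDensity δ η) (hδ : 0 < δ)
    {γ : ℝ} (hγ : 0 < γ) (hγδ : γ < δ) :
    ∃ C : ℝ≥0∞, C < ∞ ∧ ∀ t : ℝ, 0 < t →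
      ∫⁻ s in Ioi (0 : ℝ), ENNReal.ofReal (η t s) * ENNReal.ofReal (s ^ γ)
        ≤ C * ENNReal.ofReal (t ^ (γ / δ)) := by
  have hbase : ((2 : ℝ) ^ (γ - δ)) < 1 :=
    Real.rpow_lt_one_of_one_lt_of_neg (by norm_num) (by linarith)
  have hgeo : Summable fun j : ℕ => 2 * 2 ^ γ * ((2 : ℝ) ^ (γ - δ)) ^ j :=
    (summable_geometric_of_lt_one (by positivity) hbase).mul_left _
  refine ⟨1 + ∑' j : ℕ, ENNReal.ofReal (2 * 2 ^ γ * ((2 : ℝ) ^ (γ - δ)) ^ j), ?_, fun t ht => ?_⟩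
  · rw [← ENNReal.ofReal_tsum_of_nonneg (fun j => by positivity) hgeo]
    exact ENNReal.add_lt_top.2 ⟨ENNReal.one_lt_top, ENNReal.ofReal_lt_top⟩
  -- `T` is the self-similar time scale of the subordinator. Since `T ^ δ = t`, the `j`-th term
  -- integrates to at most a multiple of `2^(j(γ - δ))`, independent of `t` and summable because `γ
  -- < δ`.
  set T := t ^ (1 / δ) with hT
  have hTpos : 0 < T := by positivity
  have hmη : AEMeasurable (η t) (volume.restrict (Ioi 0)) :=
    (hη.integrableOn_self ht).aestronglyMeasurable.aemeasurable
  have hterm : ∀ j : ℕ, ∫⁻ s in Ioi (0 : ℝ), ENNReal.ofReal (η t s) * ENNReal.ofReal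
      (2 * 2 ^ γ * (2 ^ j) ^ γ * (1 - Real.exp (-(s / T) / 2 ^ j)))
        ≤ ENNReal.ofReal (2 * 2 ^ γ * ((2 : ℝ) ^ (γ - δ)) ^ j) := by
    intro j
    have hl : (0 : ℝ) < 1 / (T * 2 ^ j) := by positivity
    calc _ = ∫⁻ s in Ioi (0 : ℝ), ENNReal.ofReal (2 * 2 ^ γ * (2 ^ j) ^ γ) *
          ENNReal.ofReal (η t s * (1 - Real.exp (-s * (1 / (T * 2 ^ j))))) := by
          refine setLIntegral_congr_fun measurableSet_Ioi fun s hs => ?_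
          have e : -(s / T) / 2 ^ j = -s * (1 / (T * 2 ^ j)) := by field_simp
          simp only [e]
          rw [ENNReal.ofReal_mul (by positivity), ENNReal.ofReal_mul (hη.nonneg t ht s hs)]
          ring
      _ = ENNReal.ofReal (2 * 2 ^ γ * (2 ^ j) ^ γ) * ∫⁻ s in Ioi (0 : ℝ),
          ENNReal.ofReal (η t s * (1 - Real.exp (-s * (1 / (T * 2 ^ j))))) :=
          lintegral_const_mul' _ _ ENNReal.ofReal_ne_top
      _ ≤ ENNReal.ofReal (2 * 2 ^ γ * (2 ^ j) ^ γ) * ENNReal.ofReal (t * (1 / (T * 2 ^ j)) ^ δ) := by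
          gcongr
          exact hη.lintegral_one_sub_exp_le ht hl
      _ = ENNReal.ofReal (2 * 2 ^ γ * ((2 : ℝ) ^ (γ - δ)) ^ j) := by
          rw [← ENNReal.ofReal_mul (by positivity)]
          congr 1
          have e1 : T ^ δ = t := by
            rw [hT, ← Real.rpow_mul ht.le]; field_simp; simp
          rw [Real.div_rpow (by norm_num) (by positivity), Real.mul_rpow hTpos.le (by positivity), e1,
            Real.rpow_sub (by norm_num), div_pow, Real.one_rpow,
            ← Real.rpow_natCast 2 j, ← Real.rpow_natCast, ← Real.rpow_natCast,
            ← Real.rpow_mul (by norm_num), ← Real.rpow_mul (by norm_num),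
            ← Real.rpow_mul (by norm_num), ← Real.rpow_mul (by norm_num), mul_comm (j : ℝ) γ,
            mul_comm (j : ℝ) δ]
          field_simp
  calc ∫⁻ s in Ioi (0 : ℝ), ENNReal.ofReal (η t s) * ENNReal.ofReal (s ^ γ)
      ≤ ∫⁻ s in Ioi (0 : ℝ), ENNReal.ofReal (t ^ (γ / δ)) * (ENNReal.ofReal (η t s) +
        ∑' j : ℕ, ENNReal.ofReal (η t s) * ENNReal.ofReal
          (2 * 2 ^ γ * (2 ^ j) ^ γ * (1 - Real.exp (-(s / T) / 2 ^ j)))) := by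
        refine setLIntegral_mono' measurableSet_Ioi fun s hs => ?_
        have hs' : (0 : ℝ) < s := hs
        have h1 := rpow_le_one_add_tsum hγ (div_pos hs' hTpos)
        have h2 : s ^ γ = t ^ (γ / δ) * (s / T) ^ γ := by
          rw [Real.div_rpow hs'.le hTpos.le, hT, ← Real.rpow_mul ht.le]
          have : 1 / δ * γ = γ / δ := by ring
          rw [this]
          have : (0 : ℝ) < t ^ (γ / δ) := by positivity
          field_simp
        rw [ENNReal.tsum_mul_left, h2, ENNReal.ofReal_mul (by positivity)]
        calc _ = ENNReal.ofReal (t ^ (γ / δ)) *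
              (ENNReal.ofReal (η t s) * ENNReal.ofReal ((s / T) ^ γ)) := by ring
          _ ≤ ENNReal.ofReal (t ^ (γ / δ)) * (ENNReal.ofReal (η t s) * (1 + _)) := by gcongr
          _ = _ := by rw [mul_add, mul_one]
    _ = ENNReal.ofReal (t ^ (γ / δ)) * ((∫⁻ s in Ioi (0 : ℝ), ENNReal.ofReal (η t s)) +
        ∑' j : ℕ, ∫⁻ s in Ioi (0 : ℝ), ENNReal.ofReal (η t s) * ENNReal.ofReal
          (2 * 2 ^ γ * (2 ^ j) ^ γ * (1 - Real.exp (-(s / T) / 2 ^ j)))) := by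
        rw [lintegral_const_mul' _ _ ENNReal.ofReal_ne_top, lintegral_add_left' hmη.ennreal_ofReal,
          lintegral_tsum]
        intro j
        exact hmη.ennreal_ofReal.mul (by fun_prop)
    _ ≤ ENNReal.ofReal (t ^ (γ / δ)) *
        (1 + ∑' j : ℕ, ENNReal.ofReal (2 * 2 ^ γ * ((2 : ℝ) ^ (γ - δ)) ^ j)) := by
        gcongr with j
        · exact hη.lintegral_le_one ht
        · exact hterm j
    _ = _ := mul_comm _ _

lemma exp_neg_sub_exp_neg_le {x y : ℝ} (hx : 0 ≤ x) (hxy : x ≤ y) :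
    Real.exp (-x) - Real.exp (-y) ≤ y - x := by
  have h1 := Real.add_one_le_exp (x - y)
  have h2 : Real.exp (-y) = Real.exp (-x) * Real.exp (x - y) := by rw [← Real.exp_add]; ring_nf
  have h3 : Real.exp (-x) ≤ 1 := Real.exp_le_one_iff.2 (by linarith)
  rw [h2]
  nlinarith [Real.exp_pos (-x)]

lemma le_exp_neg_sub_exp_neg (x y : ℝ) :
    Real.exp (-y) * (y - x) ≤ Real.exp (-x) - Real.exp (-y) := by
  have h1 := Real.add_one_le_exp (y - x)
  have h2 : Real.exp (-x) = Real.exp (-y) * Real.exp (y - x) := by rw [← Real.exp_add]; ring_nf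
  rw [h2]
  nlinarith [Real.exp_pos (-y)]

/-- A combination of exponentials that is bounded by the indicator of `[a, b]` up to small errors. -/
lemma exp_sub_exp_le_indicator {a b x : ℝ} (ha : 0 < a) (hx : 0 < x) :
    Real.exp (-x) - Real.exp (-(2 * x)) ≤ (Icc a b).indicator (fun _ => (1 : ℝ)) x +
      2 * Real.exp 1 * a * (Real.exp (-(x / (2 * a))) - Real.exp (-(x / a))) +
      Real.exp (-(b / 2)) * (Real.exp (-(x / 2)) - Real.exp (-(3 / 2 * x))) := by
  have hA : 0 ≤ Real.exp (-(x / (2 * a))) - Real.exp (-(x / a)) := by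
    rw [sub_nonneg]
    apply Real.exp_le_exp.2
    rw [neg_le_neg_iff]
    gcongr
    linarith
  have hB : 0 ≤ Real.exp (-(x / 2)) - Real.exp (-(3 / 2 * x)) := by
    rw [sub_nonneg]
    apply Real.exp_le_exp.2
    linarith
  have hA' : 0 ≤ 2 * Real.exp 1 * a * (Real.exp (-(x / (2 * a))) - Real.exp (-(x / a))) := by
    positivity
  have hB' : 0 ≤ Real.exp (-(b / 2)) * (Real.exp (-(x / 2)) - Real.exp (-(3 / 2 * x))) := by
    positivity
  have hI : 0 ≤ (Icc a b).indicator (fun _ => (1 : ℝ)) x :=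
    indicator_nonneg (fun _ _ => zero_le_one) _
  -- Below `a` the left side is at most `x`, which the second term dominates; between `a` and `b`
  -- the indicator suffices; above `b` a factor `exp(-x/2) ≤ exp(-b/2)` splits off. Both errors are
  -- differences of exponentials, so their `η_t`-integrals are explicit.
  rcases lt_or_ge x a with h | h
  · have h1 := exp_neg_sub_exp_neg_le hx.le (by linarith : x ≤ 2 * x)
    have h2 := le_exp_neg_sub_exp_neg (x / (2 * a)) (x / a)
    have h3 : x / a - x / (2 * a) = x / (2 * a) := by field_simp; ring
    have h4 : Real.exp (-1) ≤ Real.exp (-(x / a)) := by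
      apply Real.exp_le_exp.2
      rw [neg_le_neg_iff, div_le_one ha]
      exact h.le
    have h5 : x ≤ 2 * Real.exp 1 * a * (Real.exp (-(x / (2 * a))) - Real.exp (-(x / a))) := by
      calc x = 2 * Real.exp 1 * a * (Real.exp (-1) * (x / (2 * a))) := by
            rw [Real.exp_neg]
            field_simp
        _ ≤ 2 * Real.exp 1 * a * (Real.exp (-(x / a)) * (x / (2 * a))) := by gcongr
        _ ≤ _ := by
            rw [h3] at h2
            gcongr
    linarith
  rcases le_or_gt x b with h' | h'
  · rw [indicator_of_mem (show x ∈ Icc a b from ⟨h, h'⟩)]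
    have h1 : Real.exp (-x) ≤ 1 := Real.exp_le_one_iff.2 (by linarith)
    linarith [Real.exp_pos (-(2 * x))]
  · have h1 : Real.exp (-x) - Real.exp (-(2 * x)) =
        Real.exp (-(x / 2)) * (Real.exp (-(x / 2)) - Real.exp (-(3 / 2 * x))) := by
      rw [mul_sub, ← Real.exp_add, ← Real.exp_add]
      ring_nf
    have h2 : Real.exp (-(x / 2)) ≤ Real.exp (-(b / 2)) := Real.exp_le_exp.2 (by linarith)
    have h3 := mul_le_mul_of_nonneg_right h2 hB
    linarith

/-- The `δ`-stable subordinator at time `t ≤ u ^ δ` has mass of order at least `t * u ^ (-δ)` in a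
window of order `u`. -/
lemma IsSubordinatorDensity.le_mass (hη : IsSubordinatorDensity δ η) (hδ : 0 < δ) (hδ1 : δ < 1) :
    ∃ a b c : ℝ, 0 < a ∧ 0 < b ∧ 0 < c ∧ ∀ u t : ℝ, 0 < u → 0 < t → t ≤ u ^ δ →
      ENNReal.ofReal (c * (t * u ^ (-δ))) ≤
        ∫⁻ s in Icc (a * u) (b * u), ENNReal.ofReal (η t s) := by
  have h2δ : 1 < (2 : ℝ) ^ δ := Real.one_lt_rpow (by norm_num) hδ
  have h2δ' : (2 : ℝ) ^ δ ≤ 2 := by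
    simpa using Real.rpow_le_rpow_of_exponent_le (by norm_num : (1 : ℝ) ≤ 2) hδ1.le
  -- With `τ = t * u^(-δ) ≤ 1`, the main difference of Laplace transforms will be at least `4 ε τ`.
  -- The window `[a, b]` is chosen so that each error is at most `ε τ`: `a` solves `2 e a (1/a)^δ =
  -- ε`, where `δ < 1` enters, and `b = 4/ε` gives `exp(-b/2) ≤ ε/2`.
  set ε : ℝ := Real.exp (-2) * (2 ^ δ - 1) / 4 with hε
  have hεpos : 0 < ε := by
    have : 0 < (2 : ℝ) ^ δ - 1 := by linarith
    positivity
  set a : ℝ := (ε / (2 * Real.exp 1)) ^ (1 / (1 - δ)) with ha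
  have hapos : 0 < a := by positivity
  have haδ : a * (1 / a) ^ δ = ε / (2 * Real.exp 1) := by
    have e1 : a * (1 / a) ^ δ = a ^ (1 - δ) := by
      rw [one_div, Real.inv_rpow hapos.le, Real.rpow_sub hapos, Real.rpow_one, div_eq_mul_inv]
    rw [e1, ha, ← Real.rpow_mul (by positivity), one_div_mul_cancel (by linarith), Real.rpow_one]
  have hbε : Real.exp (-(4 / ε / 2)) ≤ ε / 2 := by
    rw [Real.exp_neg]
    have h1 : 2 / ε ≤ Real.exp (4 / ε / 2) := by
      have := Real.add_one_le_exp (4 / ε / 2)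
      have e : 4 / ε / 2 = 2 / ε := by ring
      rw [e] at this ⊢
      linarith
    calc (Real.exp (4 / ε / 2))⁻¹ ≤ (2 / ε)⁻¹ := inv_anti₀ (by positivity) h1
      _ = ε / 2 := by rw [inv_div]
  refine ⟨a, 4 / ε, ε, hapos, by positivity, hεpos, fun u t hu ht htu => ?_⟩
  set b : ℝ := 4 / ε with hb
  set τ : ℝ := t * u ^ (-δ) with hτ
  have hτpos : 0 < τ := by positivity
  have hτ1 : τ ≤ 1 := by
    rw [hτ, Real.rpow_neg hu.le]
    exact mul_inv_le_one_of_le₀ htu (by positivity)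
  -- Rescaling time by `u` leaves `τ` as the only parameter.
  have hlap : ∀ k : ℝ, 0 < k →
      IntegrableOn (fun s => η t s * Real.exp (-(k * (s / u)))) (Ioi 0) ∧
      ∫ s in Ioi (0 : ℝ), η t s * Real.exp (-(k * (s / u))) = Real.exp (-(τ * k ^ δ)) := by
    intro k hk
    have e : ∀ s : ℝ, -(k * (s / u)) = -s * (k / u) := fun s => by ring
    simp only [e]
    refine ⟨hη.integrableOn t ht (k / u) (by positivity), ?_⟩
    rw [hη.laplace t ht (k / u) (by positivity), Real.div_rpow hk.le hu.le, hτ,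
      Real.rpow_neg hu.le]
    ring_nf
  have hdiff : ∀ k l : ℝ, 0 < k → 0 < l →
      IntegrableOn (fun s => η t s * (Real.exp (-(k * (s / u))) - Real.exp (-(l * (s / u)))))
        (Ioi 0) ∧
      ∫ s in Ioi (0 : ℝ), η t s * (Real.exp (-(k * (s / u))) - Real.exp (-(l * (s / u)))) =
        Real.exp (-(τ * k ^ δ)) - Real.exp (-(τ * l ^ δ)) := by
    intro k l hk hl
    simp only [mul_sub]
    refine ⟨(hlap k hk).1.sub (hlap l hl).1, ?_⟩
    rw [integral_sub (hlap k hk).1 (hlap l hl).1, (hlap k hk).2, (hlap l hl).2]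
  have hsub : Icc (a * u) (b * u) ⊆ Ioi 0 := fun s hs => lt_of_lt_of_le (by positivity) hs.1
  have hIcc : IntegrableOn (η t) (Icc (a * u) (b * u)) := (hη.integrableOn_self ht).mono_set hsub
  have hind : IntegrableOn ((Icc (a * u) (b * u)).indicator (η t)) (Ioi 0) :=
    (hη.integrableOn_self ht).indicator measurableSet_Icc
  obtain ⟨i1, e1⟩ := hdiff 1 2 one_pos two_pos
  obtain ⟨i2, e2⟩ := hdiff (1 / (2 * a)) (1 / a) (by positivity) (by positivity)
  obtain ⟨i3, e3⟩ := hdiff (1 / 2) (3 / 2) (by norm_num) (by norm_num)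
  have key : Real.exp (-(τ * 1 ^ δ)) - Real.exp (-(τ * 2 ^ δ)) ≤
      (∫ s in Icc (a * u) (b * u), η t s) +
      2 * Real.exp 1 * a * (Real.exp (-(τ * (1 / (2 * a)) ^ δ)) - Real.exp (-(τ * (1 / a) ^ δ))) +
      Real.exp (-(b / 2)) * (Real.exp (-(τ * (1 / 2) ^ δ)) - Real.exp (-(τ * (3 / 2) ^ δ))) := by
    rw [← e1, ← e2, ← e3, ← integral_const_mul, ← integral_const_mul]
    have e4 : ∫ s in Icc (a * u) (b * u), η t s =
        ∫ s in Ioi (0 : ℝ), (Icc (a * u) (b * u)).indicator (η t) s := by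
      rw [setIntegral_indicator measurableSet_Icc, inter_eq_self_of_subset_right hsub]
    have j2 := i2.const_mul (2 * Real.exp 1 * a)
    have j3 := i3.const_mul (Real.exp (-(b / 2)))
    have j12 : IntegrableOn (fun s => (Icc (a * u) (b * u)).indicator (η t) s +
      2 * Real.exp 1 * a * (η t s * (Real.exp (-(1 / (2 * a) * (s / u))) -
        Real.exp (-(1 / a * (s / u)))))) (Ioi 0) := hind.add j2
    rw [e4, ← integral_add hind j2, ← integral_add j12 j3]
    refine setIntegral_mono_on i1 (j12.add j3) measurableSet_Ioi fun s hs => ?_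
    have hs' : (0 : ℝ) < s := hs
    have h1 := mul_le_mul_of_nonneg_left
      (exp_sub_exp_le_indicator (b := b) hapos (div_pos hs' hu)) (hη.nonneg t ht s hs)
    have h2 : (Icc (a * u) (b * u)).indicator (η t) s =
        η t s * (Icc a b).indicator (fun _ => (1 : ℝ)) (s / u) := by
      have : s ∈ Icc (a * u) (b * u) ↔ s / u ∈ Icc a b := by
        simp only [mem_Icc, le_div_iff₀ hu, div_le_iff₀ hu]
      by_cases h : s ∈ Icc (a * u) (b * u)
      · rw [indicator_of_mem h, indicator_of_mem (this.1 h), mul_one]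
      · rw [indicator_of_notMem h, indicator_of_notMem (fun h' => h (this.2 h')), mul_zero]
    have e5 : s / u / (2 * a) = 1 / (2 * a) * (s / u) := by ring
    have e6 : s / u / a = 1 / a * (s / u) := by ring
    have e7 : s / u / 2 = 1 / 2 * (s / u) := by ring
    rw [e5, e6, e7] at h1
    simp only [h2, one_mul]
    linarith
  have l1 : Real.exp (-2) * (2 ^ δ - 1) * τ ≤
      Real.exp (-(τ * 1 ^ δ)) - Real.exp (-(τ * 2 ^ δ)) := by
    refine le_trans ?_ (le_exp_neg_sub_exp_neg _ _)
    rw [Real.one_rpow]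
    have h1 : Real.exp (-2) ≤ Real.exp (-(τ * 2 ^ δ)) := by
      apply Real.exp_le_exp.2
      nlinarith
    have h2 : 0 ≤ ((2 : ℝ) ^ δ - 1) * τ := mul_nonneg (by linarith) hτpos.le
    nlinarith
  have l2 : 2 * Real.exp 1 * a *
      (Real.exp (-(τ * (1 / (2 * a)) ^ δ)) - Real.exp (-(τ * (1 / a) ^ δ))) ≤ ε * τ := by
    have h1 : (1 / (2 * a)) ^ δ ≤ (1 / a) ^ δ := by
      gcongr
      linarith
    have h2 : 0 ≤ (1 / (2 * a)) ^ δ := by positivity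
    have h3 := exp_neg_sub_exp_neg_le (mul_nonneg hτpos.le h2)
      (mul_le_mul_of_nonneg_left h1 hτpos.le)
    calc _ ≤ 2 * Real.exp 1 * a * (τ * (1 / a) ^ δ) := by
          gcongr
          have := mul_nonneg hτpos.le h2
          linarith
      _ = 2 * Real.exp 1 * τ * (a * (1 / a) ^ δ) := by ring
      _ = ε * τ := by rw [haδ]; field_simp
  have l3 : Real.exp (-(b / 2)) *
      (Real.exp (-(τ * (1 / 2) ^ δ)) - Real.exp (-(τ * (3 / 2) ^ δ))) ≤ ε * τ := by
    have h1 : (1 / 2 : ℝ) ^ δ ≤ (3 / 2) ^ δ := by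
      gcongr
      norm_num
    have h2 : (0 : ℝ) ≤ (1 / 2) ^ δ := by positivity
    have h3 := exp_neg_sub_exp_neg_le (mul_nonneg hτpos.le h2)
      (mul_le_mul_of_nonneg_left h1 hτpos.le)
    have h4 : (3 / 2 : ℝ) ^ δ ≤ 3 / 2 := by
      simpa using Real.rpow_le_rpow_of_exponent_le (by norm_num : (1 : ℝ) ≤ 3 / 2) hδ1.le
    calc _ ≤ ε / 2 * (2 * τ) := by
          refine mul_le_mul hbε ?_ ?_ (by positivity)
          · have := mul_nonneg hτpos.le h2
            nlinarith
          · rw [sub_nonneg]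
            apply Real.exp_le_exp.2
            rw [neg_le_neg_iff]
            gcongr
      _ = ε * τ := by ring
  rw [← ofReal_integral_eq_lintegral_ofReal hIcc]
  · apply ENNReal.ofReal_le_ofReal
    have : Real.exp (-2) * (2 ^ δ - 1) = 4 * ε := by rw [hε]; ring
    rw [this] at l1
    nlinarith
  · filter_upwards [ae_restrict_mem measurableSet_Icc] with s hs using hη.nonneg t ht s (hsub hs)

end Subordinator
-- Continuity in time of the semigroup and kernel integrals over rectangles.
section HeatSemigroup

variable {X : Type*} [MeasurableSpace X] {μ : Measure X}

lemma DirichletForm.IsHeatSemigroup.norm_sub_le {E : DirichletForm μ}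
    {P : ℝ → Lp ℝ 2 μ →L[ℝ] Lp ℝ 2 μ} (hP : E.IsHeatSemigroup P) (f : Lp ℝ 2 μ) {s h : ℝ}
    (hs : 0 < s) (hh : 0 < h) : ‖P (s + h) f - P s f‖ ≤ ‖P h f - f‖ := by
  rw [hP.semigroup s h hs hh, ContinuousLinearMap.comp_apply, ← map_sub]
  calc _ ≤ ‖P s‖ * ‖P h f - f‖ := (P s).le_opNorm _
    _ ≤ 1 * ‖P h f - f‖ := by gcongr; exact hP.contraction s hs
    _ = _ := one_mul _

/-- The semigroup law and contractivity bound `‖P_r f - P_s f‖` by `‖P_|r-s| f - f‖`, so strong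
continuity at `0` gives two-sided continuity at every `s > 0`. -/
lemma DirichletForm.IsHeatSemigroup.continuousOn {E : DirichletForm μ}
    {P : ℝ → Lp ℝ 2 μ →L[ℝ] Lp ℝ 2 μ} (hP : E.IsHeatSemigroup P) (f : Lp ℝ 2 μ) :
    ContinuousOn (fun s => P s f) (Ioi 0) := by
  intro s hs
  refine ContinuousAt.continuousWithinAt ?_
  rw [continuousAt_iff_punctured_nhds, tendsto_iff_norm_sub_tendsto_zero]
  have habs : Tendsto (fun r : ℝ => |r - s|) (𝓝[≠] s) (𝓝[>] 0) := by
    refine tendsto_nhdsWithin_iff.2 ⟨?_, ?_⟩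
    · have : Tendsto (fun r : ℝ => |r - s|) (𝓝 s) (𝓝 |s - s|) := by
        apply Continuous.tendsto (by fun_prop)
      simpa using this.mono_left nhdsWithin_le_nhds
    · filter_upwards [self_mem_nhdsWithin] with r hr
      exact abs_pos.2 (sub_ne_zero.2 hr)
  have hlim : Tendsto (fun r : ℝ => ‖P |r - s| f - f‖) (𝓝[≠] s) (𝓝 0) :=
    (tendsto_iff_norm_sub_tendsto_zero.1 (hP.strongly_continuous f)).comp habs
  refine squeeze_zero' (Eventually.of_forall fun _ => norm_nonneg _) ?_ hlim
  filter_upwards [self_mem_nhdsWithin, nhdsWithin_le_nhds (Ioi_mem_nhds hs)] with r hr hr0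
  have hr0 : 0 < r := hr0
  rcases lt_or_gt_of_ne (show r ≠ s from hr) with h | h
  · rw [abs_of_neg (by linarith), norm_sub_rev]
    have := hP.norm_sub_le f hr0 (show 0 < -(r - s) by linarith)
    rwa [show r + -(r - s) = s by ring] at this
  · rw [abs_of_pos (by linarith)]
    have := hP.norm_sub_le f hs (show 0 < r - s by linarith)
    rwa [show s + (r - s) = r by ring] at this

/-- Rectangle integrals translate kernel statements into `L²` pairings of indicators, where the
operators themselves are available. -/
lemma IsHeatKernel.setLIntegral_prod [SFinite μ] {T : ℝ → Lp ℝ 2 μ → Lp ℝ 2 μ}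
    {k : ℝ → X → X → ℝ}
    (hk : IsHeatKernel T k) {t : ℝ} (ht : 0 < t) {A B : Set X} (hA : MeasurableSet A)
    (hB : MeasurableSet B) (hμA : μ A ≠ ∞) (hμB : μ B ≠ ∞) :
    ∫⁻ z in A ×ˢ B, ENNReal.ofReal (k t z.1 z.2) ∂(μ.prod μ) =
      ENNReal.ofReal (inner ℝ (indicatorConstLp 2 hA hμA (1 : ℝ))
        (T t (indicatorConstLp 2 hB hμB (1 : ℝ)))) := by
  set f := indicatorConstLp 2 hB hμB (1 : ℝ) with hf
  have hmeas : Measurable (fun z : X × X => ENNReal.ofReal (k t z.1 z.2)) :=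
    (hk.measurable t ht).ennreal_ofReal
  have hfB : (f : X → ℝ) =ᵐ[μ] B.indicator (fun _ => (1 : ℝ)) := indicatorConstLp_coeFn
  have hpt : ∀ x : X, (fun y => k t x y * f y) =ᵐ[μ] B.indicator (k t x) := by
    intro x
    filter_upwards [hfB] with y hy
    rw [hy]
    by_cases h : y ∈ B <;> simp [h]
  have hinner : ∀ᵐ x ∂μ, ∫⁻ y in B, ENNReal.ofReal (k t x y) ∂μ = ENNReal.ofReal (T t f x) ∧
      0 ≤ T t f x := by
    filter_upwards [hk.integrable t ht f, hk.repr t ht f] with x hx1 hx2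
    have h1 : IntegrableOn (k t x) B μ := by
      rw [← integrable_indicator_iff hB]
      exact hx1.congr (hpt x)
    have h2 : T t f x = ∫ y in B, k t x y ∂μ := by
      rw [hx2, integral_congr_ae (hpt x), integral_indicator hB]
    refine ⟨?_, ?_⟩
    · rw [h2, ofReal_integral_eq_lintegral_ofReal h1
        (Eventually.of_forall fun y => hk.nonneg t ht x y)]
    · rw [h2]
      exact integral_nonneg fun y => hk.nonneg t ht x y
  rw [← Measure.prod_restrict, lintegral_prod _ hmeas.aemeasurable,
    L2.inner_indicatorConstLp_one hA hμA,
    ofReal_integral_eq_lintegral_ofReal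
      (integrableOn_Lp_of_measure_ne_top _ (by norm_num) hμA)
      (ae_restrict_of_ae (hinner.mono fun x hx => hx.2))]
  exact lintegral_congr_ae (ae_restrict_of_ae (hinner.mono fun x hx => hx.1))

lemma continuousOn_setLIntegral_heatKernel [SFinite μ] {E : DirichletForm μ}
    {P : ℝ → Lp ℝ 2 μ →L[ℝ] Lp ℝ 2 μ} (hP : E.IsHeatSemigroup P) {p : ℝ → X → X → ℝ}
    (hp : IsHeatKernel (fun t f => P t f) p) {A B : Set X} (hA : MeasurableSet A)
    (hB : MeasurableSet B) (hμA : μ A ≠ ∞) (hμB : μ B ≠ ∞) :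
    ContinuousOn (fun s => ∫⁻ z in A ×ˢ B, ENNReal.ofReal (p s z.1 z.2) ∂(μ.prod μ)) (Ioi 0) := by
  have : ContinuousOn (fun s => ENNReal.ofReal (inner ℝ (indicatorConstLp 2 hA hμA (1 : ℝ))
      (P s (indicatorConstLp 2 hB hμB (1 : ℝ))))) (Ioi 0) :=
    ENNReal.continuous_ofReal.comp_continuousOn
      (continuousOn_const.inner (𝕜 := ℝ) (hP.continuousOn _))
  exact this.congr fun s hs => hp.setLIntegral_prod hs hA hB hμA hμB

lemma integrableOn_subordinate {E : DirichletForm μ}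
    {P : ℝ → Lp ℝ 2 μ →L[ℝ] Lp ℝ 2 μ} (hP : E.IsHeatSemigroup P)
    {δ : ℝ} {η : ℝ → ℝ → ℝ} (hη : IsSubordinatorDensity δ η)
    {t : ℝ} (ht : 0 < t) (f : Lp ℝ 2 μ) : IntegrableOn (fun s => η t s • P s f) (Ioi 0) := by
  refine Integrable.mono' ((hη.integrableOn_self ht).mul_const ‖f‖)
    (((hη.continuousOn t ht).smul (hP.continuousOn f)).aestronglyMeasurable measurableSet_Ioi) ?_
  filter_upwards [ae_restrict_mem measurableSet_Ioi] with s hs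
  rw [norm_smul, Real.norm_of_nonneg (hη.nonneg t ht s hs)]
  refine mul_le_mul_of_nonneg_left ?_ (hη.nonneg t ht s hs)
  calc ‖P s f‖ ≤ ‖P s‖ * ‖f‖ := (P s).le_opNorm f
    _ ≤ 1 * ‖f‖ := by gcongr; exact hP.contraction s hs
    _ = ‖f‖ := one_mul _

end HeatSemigroup

/-! ### Recovering a continuous function from its averages over shrinking balls. -/

section Average

lemma tendsto_laverage_ball {Z : Type*} [PseudoMetricSpace Z] [MeasurableSpace Z]
    [OpensMeasurableSpace Z]
    (ν : Measure Z) [ν.IsOpenPosMeasure] {g : Z → ℝ≥0∞} (hg : Continuous g) (z : Z)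
    (hfin : ∀ r : ℝ, ν (Metric.ball z r) ≠ ∞) :
    Tendsto (fun n : ℕ => (∫⁻ w in Metric.ball z (1 / ((n : ℝ) + 1)), g w ∂ν) /
      ν (Metric.ball z (1 / ((n : ℝ) + 1)))) atTop (𝓝 (g z)) := by
  have hpos : ∀ n : ℕ, ν (Metric.ball z (1 / ((n : ℝ) + 1))) ≠ 0 := fun n =>
    (Metric.measure_ball_pos ν z (by positivity)).ne'
  have hsmall : ∀ U ∈ 𝓝 z, ∀ᶠ n : ℕ in atTop, Metric.ball z (1 / ((n : ℝ) + 1)) ⊆ U := by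
    intro U hU
    obtain ⟨ε, hε, hsub⟩ := Metric.mem_nhds_iff.1 hU
    filter_upwards [(tendsto_one_div_add_atTop_nhds_zero_nat (𝕜 := ℝ)).eventually
      (gt_mem_nhds hε)] with n hn
    exact (Metric.ball_subset_ball hn.le).trans hsub
  refine tendsto_order.2 ⟨fun l hl => ?_, fun l hl => ?_⟩
  · obtain ⟨l', hl1, hl2⟩ := exists_between hl
    filter_upwards [hsmall _ (hg.continuousAt.eventually (lt_mem_nhds hl2))] with n hn
    refine hl1.trans_le ?_
    rw [ENNReal.le_div_iff_mul_le (Or.inl (hpos n)) (Or.inl (hfin _)), ← setLIntegral_const]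
    exact setLIntegral_mono' Metric.isOpen_ball.measurableSet fun w hw => (hn hw).le
  · obtain ⟨l', hl1, hl2⟩ := exists_between hl
    filter_upwards [hsmall _ (hg.continuousAt.eventually (gt_mem_nhds hl1))] with n hn
    refine lt_of_le_of_lt ?_ hl2
    rw [ENNReal.div_le_iff_le_mul (Or.inl (hpos n)) (Or.inl (hfin _)), ← setLIntegral_const]
    exact setLIntegral_mono' Metric.isOpen_ball.measurableSet fun w hw => (hn hw).le

end Average

/-! ### The subordinated kernel as a time average of the heat kernel. -/

section Subordination

variable {X : Type*} [MetricSpace X] [ProperSpace X] [MeasurableSpace X] [BorelSpace X]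
  {μ : Measure X} [μ.Regular] [μ.IsOpenPosMeasure]
  {E : DirichletForm μ} {P : ℝ → Lp ℝ 2 μ →L[ℝ] Lp ℝ 2 μ} {p : ℝ → X → X → ℝ}

/-- No regularity of `p` in time is assumed. Averages over small balls of `X × X`, which are
products of balls, depend continuously on `s`; by spatial continuity they converge to the pointwise
value. -/
lemma measurable_time_heatKernel (hP : E.IsHeatSemigroup P)
    (hp : IsHeatKernel (fun t f => P t f) p)
    (hpcont : ∀ t : ℝ, 0 < t → Continuous (Function.uncurry (p t))) (z : X × X) :
    Measurable ((Ioi (0 : ℝ)).indicator fun s => ENNReal.ofReal (p s z.1 z.2)) := by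
  classical
  have hfin : ∀ r : ℝ, μ.prod μ (Metric.ball z r) ≠ ∞ := by
    intro r
    rw [← ball_prod_same, Measure.prod_prod]
    exact ENNReal.mul_ne_top measure_ball_lt_top.ne measure_ball_lt_top.ne
  refine measurable_of_tendsto_metrizable (f := fun (n : ℕ) => (Ioi (0 : ℝ)).indicator fun s =>
    (∫⁻ w in Metric.ball z (1 / ((n : ℝ) + 1)), ENNReal.ofReal (p s w.1 w.2) ∂(μ.prod μ)) /
      μ.prod μ (Metric.ball z (1 / ((n : ℝ) + 1)))) (fun n => ?_) ?_
  · have h1 : ContinuousOn (fun s => ∫⁻ w in Metric.ball z (1 / ((n : ℝ) + 1)),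
        ENNReal.ofReal (p s w.1 w.2) ∂(μ.prod μ)) (Ioi 0) := by
      rw [← ball_prod_same]
      exact continuousOn_setLIntegral_heatKernel hP hp Metric.isOpen_ball.measurableSet
        Metric.isOpen_ball.measurableSet measure_ball_lt_top.ne measure_ball_lt_top.ne
    have h2 : Measurable ((Ioi (0 : ℝ)).indicator fun s =>
        ∫⁻ w in Metric.ball z (1 / ((n : ℝ) + 1)), ENNReal.ofReal (p s w.1 w.2) ∂(μ.prod μ)) := by
      rw [← piecewise_eq_indicator]
      exact h1.measurable_piecewise continuousOn_const measurableSet_Ioi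
    convert h2.div_const (μ.prod μ (Metric.ball z (1 / ((n : ℝ) + 1)))) using 1
    ext s
    by_cases hs : s ∈ Ioi (0 : ℝ) <;> simp [hs]
  · rw [tendsto_pi_nhds]
    intro s
    by_cases hs : s ∈ Ioi (0 : ℝ)
    · simp only [indicator_of_mem hs]
      exact tendsto_laverage_ball (μ.prod μ)
        (ENNReal.continuous_ofReal.comp (hpcont s hs)) z hfin
    · simp only [indicator_of_notMem hs]
      exact tendsto_const_nhds

lemma measurable_heatKernel_uncurry (hP : E.IsHeatSemigroup P)
    (hp : IsHeatKernel (fun t f => P t f) p)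
    (hpcont : ∀ t : ℝ, 0 < t → Continuous (Function.uncurry (p t))) :
    Measurable (Function.uncurry fun (z : X × X) =>
      (Ioi (0 : ℝ)).indicator fun s => ENNReal.ofReal (p s z.1 z.2)) := by
  refine measurable_uncurry_of_continuous_of_measurable (fun s => ?_)
    (measurable_time_heatKernel hP hp hpcont)
  by_cases hs : s ∈ Ioi (0 : ℝ)
  · simp only [indicator_of_mem hs]
    exact ENNReal.continuous_ofReal.comp (hpcont s hs)
  · simp only [indicator_of_notMem hs]
    exact continuous_const

variable {δ : ℝ} {η : ℝ → ℝ → ℝ}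

/-- Tonelli for the subordinated kernel. -/
lemma lintegral_subordinate_kernel (hP : E.IsHeatSemigroup P)
    (hp : IsHeatKernel (fun t f => P t f) p)
    (hpcont : ∀ t : ℝ, 0 < t → Continuous (Function.uncurry (p t)))
    (hη : IsSubordinatorDensity δ η) {t : ℝ} (ht : 0 < t) {ν : Measure (X × X)} [SFinite ν]
    {w : X × X → ℝ≥0∞} (hw : AEMeasurable w ν) :
    ∫⁻ z, w z * (∫⁻ s in Ioi (0 : ℝ), ENNReal.ofReal (η t s) * ENNReal.ofReal (p s z.1 z.2)) ∂ν =
      ∫⁻ s in Ioi (0 : ℝ), ENNReal.ofReal (η t s) *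
        ∫⁻ z, w z * ENNReal.ofReal (p s z.1 z.2) ∂ν := by
  -- Nothing is known about `p s` for `s ≤ 0`; cutting it off there makes the kernel jointly
  -- measurable, as Tonelli requires.
  set k : X × X → ℝ → ℝ≥0∞ := fun z =>
    (Ioi (0 : ℝ)).indicator fun s => ENNReal.ofReal (p s z.1 z.2) with hk
  have hkm : Measurable (Function.uncurry k) := measurable_heatKernel_uncurry hP hp hpcont
  have hmη : AEMeasurable (fun s => ENNReal.ofReal (η t s)) (volume.restrict (Ioi 0)) :=
    (hη.integrableOn_self ht).aestronglyMeasurable.aemeasurable.ennreal_ofReal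
  have hmem : ∀ z : X × X, ∀ s ∈ Ioi (0 : ℝ), ENNReal.ofReal (p s z.1 z.2) = k z s :=
    fun z s hs =>
    (indicator_of_mem hs (fun s => ENNReal.ofReal (p s z.1 z.2))).symm
  calc _ = ∫⁻ z, (∫⁻ s in Ioi (0 : ℝ), w z * (ENNReal.ofReal (η t s) * k z s)) ∂ν := by
        refine lintegral_congr fun z => ?_
        rw [lintegral_const_mul'']
        · congr 1
          exact setLIntegral_congr_fun measurableSet_Ioi fun s hs => by
            simp only [hmem z s hs]
        · exact hmη.mul (hkm.comp (measurable_const.prodMk measurable_id)).aemeasurable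
    _ = ∫⁻ s in Ioi (0 : ℝ), ∫⁻ z, w z * (ENNReal.ofReal (η t s) * k z s) ∂ν := by
        apply lintegral_lintegral_swap
        exact hw.comp_fst.mul (hmη.comp_snd.mul hkm.aemeasurable)
    _ = _ := by
        refine setLIntegral_congr_fun measurableSet_Ioi fun s hs => ?_
        rw [← lintegral_const_mul' _ _ ENNReal.ofReal_ne_top]
        refine lintegral_congr fun z => ?_
        rw [hmem z s hs]
        ring

/-- Pairing with an indicator commutes with the `L²`-valued integral over `s`; Tonelli handles the
other side. -/
lemma setLIntegral_prod_subordinate (hP : E.IsHeatSemigroup P)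
    (hp : IsHeatKernel (fun t f => P t f) p)
    (hpcont : ∀ t : ℝ, 0 < t → Continuous (Function.uncurry (p t)))
    (hη : IsSubordinatorDensity δ η) {q : ℝ → X → X → ℝ} (hq : IsHeatKernel (subordinate η P) q)
    {t : ℝ} (ht : 0 < t) {A B : Set X} (hA : MeasurableSet A)
    (hB : MeasurableSet B) (hμA : μ A ≠ ∞) (hμB : μ B ≠ ∞) :
    ∫⁻ z in A ×ˢ B, ENNReal.ofReal (q t z.1 z.2) ∂(μ.prod μ) =
      ∫⁻ z in A ×ˢ B, (∫⁻ s in Ioi (0 : ℝ),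
        ENNReal.ofReal (η t s) * ENNReal.ofReal (p s z.1 z.2)) ∂(μ.prod μ) := by
  have h1 := lintegral_subordinate_kernel hP hp hpcont hη ht
    (ν := (μ.prod μ).restrict (A ×ˢ B)) (w := fun _ => 1) aemeasurable_const
  simp only [one_mul] at h1
  rw [h1, hq.setLIntegral_prod ht hA hB hμA hμB, subordinate,
    ← integral_inner (integrableOn_subordinate hP hη ht _)]
  have h2 : ∀ s ∈ Ioi (0 : ℝ), 0 ≤ inner ℝ (indicatorConstLp 2 hA hμA (1 : ℝ))
      (P s (indicatorConstLp 2 hB hμB (1 : ℝ))) := by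
    intro s hs
    rw [L2.inner_indicatorConstLp_one hA hμA]
    refine integral_nonneg_of_ae (ae_restrict_of_ae ?_)
    filter_upwards [hp.repr s hs (indicatorConstLp 2 hB hμB (1 : ℝ))] with x hx
    rw [hx]
    refine integral_nonneg_of_ae ?_
    filter_upwards [(indicatorConstLp_coeFn :
      (indicatorConstLp 2 hB hμB (1 : ℝ) : X → ℝ) =ᵐ[μ] _)] with y hy
    rw [hy]
    exact mul_nonneg (hp.nonneg s hs x y) (indicator_nonneg (fun _ _ => zero_le_one) _)
  rw [ofReal_integral_eq_lintegral_ofReal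
    ((integrableOn_subordinate hP hη ht _).const_inner _)]
  · refine setLIntegral_congr_fun measurableSet_Ioi fun s hs => ?_
    rw [hp.setLIntegral_prod hs hA hB hμA hμB, inner_smul_right,
      ENNReal.ofReal_mul (hη.nonneg t ht s hs)]
  · filter_upwards [ae_restrict_mem measurableSet_Ioi] with s hs
    rw [inner_smul_right]
    exact mul_nonneg (hη.nonneg t ht s hs) (h2 s hs)

/-- The heat kernel of the subordinated semigroup is the subordinated heat kernel. -/
lemma subordinate_kernel_ae_eq (hP : E.IsHeatSemigroup P)
    (hp : IsHeatKernel (fun t f => P t f) p)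
    (hpcont : ∀ t : ℝ, 0 < t → Continuous (Function.uncurry (p t)))
    (hη : IsSubordinatorDensity δ η) {q : ℝ → X → X → ℝ} (hq : IsHeatKernel (subordinate η P) q)
    {t : ℝ} (ht : 0 < t) :
    ∀ᵐ z ∂(μ.prod μ), ENNReal.ofReal (q t z.1 z.2) =
      ∫⁻ s in Ioi (0 : ℝ), ENNReal.ofReal (η t s) * ENNReal.ofReal (p s z.1 z.2) := by
  set F : X × X → ℝ≥0∞ := fun z => ENNReal.ofReal (q t z.1 z.2) with hF
  set G : X × X → ℝ≥0∞ := fun z =>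
    ∫⁻ s in Ioi (0 : ℝ), ENNReal.ofReal (η t s) * ENNReal.ofReal (p s z.1 z.2) with hG
  have hFm : Measurable F := (hq.measurable t ht).ennreal_ofReal
  have hGm : AEMeasurable G (μ.prod μ) := by
    set k : X × X → ℝ → ℝ≥0∞ := fun z =>
      (Ioi (0 : ℝ)).indicator fun s => ENNReal.ofReal (p s z.1 z.2) with hk
    have hkm : Measurable (Function.uncurry k) := measurable_heatKernel_uncurry hP hp hpcont
    have hmη : AEMeasurable (fun s => ENNReal.ofReal (η t s)) (volume.restrict (Ioi 0)) :=
      (hη.integrableOn_self ht).aestronglyMeasurable.aemeasurable.ennreal_ofReal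
    have h1 : AEMeasurable (fun z : (X × X) × ℝ => ENNReal.ofReal (η t z.2) * k z.1 z.2)
        ((μ.prod μ).prod (volume.restrict (Ioi 0))) := hmη.comp_snd.mul hkm.aemeasurable
    refine h1.lintegral_prod_right'.congr (Eventually.of_forall fun z => ?_)
    exact setLIntegral_congr_fun measurableSet_Ioi fun s hs => by
      simp only [hk, indicator_of_mem hs]
  have hcover : ⋃ n, (spanningSets μ n ×ˢ spanningSets μ n) = (univ : Set (X × X)) := by
    rw [iUnion_prod_of_monotone (monotone_spanningSets μ) (monotone_spanningSets μ),
      iUnion_spanningSets, univ_prod_univ]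
  rw [← Measure.restrict_univ (μ := μ.prod μ), ← hcover, ae_restrict_iUnion_iff]
  intro n
  set S := spanningSets μ n
  have hS : MeasurableSet S := measurableSet_spanningSets μ n
  have hμS : μ S ≠ ∞ := (measure_spanningSets_lt_top μ n).ne
  -- Finiteness on `S ×ˢ S` allows both densities to be identified from the measures they define,
  -- and finite measures on a product are determined by rectangles.
  have hfin : ∫⁻ z in S ×ˢ S, F z ∂(μ.prod μ) ≠ ∞ := by
    rw [hq.setLIntegral_prod ht hS hS hμS hμS]
    exact ENNReal.ofReal_ne_top
  refine (withDensity_eq_iff hFm.aemeasurable hGm.restrict hfin).1 ?_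
  have : IsFiniteMeasure (((μ.prod μ).restrict (S ×ˢ S)).withDensity F) :=
    isFiniteMeasure_withDensity hfin
  refine Measure.ext_prod fun {A B} hA hB => ?_
  rw [withDensity_apply _ (hA.prod hB), withDensity_apply _ (hA.prod hB),
    Measure.restrict_restrict (hA.prod hB), prod_inter_prod]
  exact setLIntegral_prod_subordinate hP hp hpcont hη hq ht (hA.inter hS) (hB.inter hS)
    (measure_inter_lt_top_of_right_ne_top hμS).ne (measure_inter_lt_top_of_right_ne_top hμS).ne

lemma lintegral_mul_subordinate_kernel (hP : E.IsHeatSemigroup P)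
    (hp : IsHeatKernel (fun t f => P t f) p)
    (hpcont : ∀ t : ℝ, 0 < t → Continuous (Function.uncurry (p t)))
    (hη : IsSubordinatorDensity δ η) {q : ℝ → X → X → ℝ} (hq : IsHeatKernel (subordinate η P) q)
    {t : ℝ} (ht : 0 < t) {w : X × X → ℝ≥0∞} (hw : AEMeasurable w (μ.prod μ)) :
    ∫⁻ z, w z * ENNReal.ofReal (q t z.1 z.2) ∂(μ.prod μ) =
      ∫⁻ s in Ioi (0 : ℝ), ENNReal.ofReal (η t s) *
        ∫⁻ z, w z * ENNReal.ofReal (p s z.1 z.2) ∂(μ.prod μ) := by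
  rw [← lintegral_subordinate_kernel hP hp hpcont hη ht hw]
  refine lintegral_congr_ae ?_
  filter_upwards [subordinate_kernel_ae_eq hP hp hpcont hη hq ht] with z hz
  rw [hz]

end Subordination
-- Oscillation at scale `r`, against Korevaar–Schoen and heat energies.
section Oscillation

variable {X : Type*} [MeasurableSpace X] {μ : Measure X}

lemma aemeasurable_ofReal_abs_sub [SFinite μ] {f : X → ℝ} (hf : AEMeasurable f μ) :
    AEMeasurable (fun z : X × X => ENNReal.ofReal |f z.1 - f z.2|) (μ.prod μ) :=
  ((continuous_abs.measurable.comp_aemeasurable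
    (hf.comp_fst.sub hf.comp_snd))).ennreal_ofReal

lemma lintegral_ofReal_abs_lt_top {f : X → ℝ} (hf : MemLp f (ENNReal.ofReal 1) μ) :
    ∫⁻ x, ENNReal.ofReal |f x| ∂μ < ∞ := by
  rw [ENNReal.ofReal_one, memLp_one_iff_integrable] at hf
  have := hf.hasFiniteIntegral
  rwa [hasFiniteIntegral_iff_norm] at this

variable [MetricSpace X]

/-- The total oscillation of `f` at scale `r`, `∫∫_{d(x, y) < r} |f(x) - f(y)| dμ(x) dμ(y)`. -/
noncomputable def oscillation (μ : Measure X) (f : X → ℝ) (r : ℝ) : ℝ≥0∞ :=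
  ∫⁻ z in {z : X × X | dist z.1 z.2 < r}, ENNReal.ofReal |f z.1 - f z.2| ∂(μ.prod μ)

/-- The Korevaar–Schoen energy of `f` at scale `r`. -/
noncomputable def ksEnergy (μ : Measure X) (lam : ℝ) (f : X → ℝ) (r : ℝ) : ℝ≥0∞ :=
  ∫⁻ x, ∫⁻ y in Metric.ball x r, ENNReal.ofReal (|f x - f y| ^ (1 : ℝ)) /
    (ENNReal.ofReal (r ^ (lam * 1)) * μ (Metric.ball x r)) ∂μ ∂μ

lemma ksSeminormPow_one (lam : ℝ) (f : X → ℝ) :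
    ksSeminormPow μ lam 1 f = limsup (ksEnergy μ lam f) (𝓝[>] 0) := rfl

section

variable [SFinite μ]

lemma isConstant_of_oscillation_eq_zero {f : X → ℝ} (hf : AEMeasurable f μ)
    (h : ∀ r : ℝ, 0 < r → oscillation μ f r = 0) : IsConstant μ f := by
  have hcover : ⋃ n : ℕ, {z : X × X | dist z.1 z.2 < (n : ℝ) + 1} = univ := by
    refine eq_univ_of_forall fun z => mem_iUnion.2 ?_
    obtain ⟨n, hn⟩ := exists_nat_gt (dist z.1 z.2)
    exact ⟨n, by simp only [mem_ofPred_eq]; linarith⟩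
  have hae : ∀ᵐ z ∂(μ.prod μ), f z.1 = f z.2 := by
    rw [← Measure.restrict_univ (μ := μ.prod μ), ← hcover, ae_restrict_iUnion_iff]
    intro n
    have h1 := h ((n : ℝ) + 1) (by positivity)
    rw [oscillation, lintegral_eq_zero_iff' (aemeasurable_ofReal_abs_sub hf).restrict] at h1
    filter_upwards [h1] with z hz
    have h2 : |f z.1 - f z.2| ≤ 0 := ENNReal.ofReal_eq_zero.1 hz
    exact sub_eq_zero.1 (abs_nonpos_iff.1 h2)
  rcases eq_or_ne μ 0 with hμ | hμ
  · exact ⟨0, by simp [hμ, Filter.EventuallyEq]⟩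
  · have : (ae μ).NeBot := ae_neBot.2 hμ
    obtain ⟨x, hx⟩ := (Measure.ae_ae_of_ae_prod hae).exists
    exact ⟨f x, hx.mono fun y hy => hy.symm⟩

end

variable [SecondCountableTopology X] [BorelSpace X]

lemma measurableSet_dist_lt (r : ℝ) : MeasurableSet {z : X × X | dist z.1 z.2 < r} :=
  (isOpen_lt (by fun_prop) continuous_const).measurableSet

/-- Lower bound of the heat energy of `f` by its oscillations. -/
lemma HasSubGaussianEstimates.exists_le_lintegral {dH dW : ℝ} (hdH : 0 < dH) (hdW : 2 ≤ dW)
    {p : ℝ → X → X → ℝ} (hp : HasSubGaussianEstimates μ dH dW p) {a b : ℝ} (ha : 0 < a)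
    (hb : 0 < b) :
    ∃ c : ℝ, 0 < c ∧ ∀ (f : X → ℝ) (r s : ℝ), 0 < r → s ∈ Icc (a * r ^ dW) (b * r ^ dW) →
      ENNReal.ofReal (c * r ^ (-dH)) * oscillation μ f r ≤
        ∫⁻ z, ENNReal.ofReal |f z.1 - f z.2| * ENNReal.ofReal (p s z.1 z.2) ∂(μ.prod μ) := by
  obtain ⟨_, _, c₅, c₆, _, _, hc₅, hc₆, hest⟩ := hp
  have hdW0 : 0 < dW := by linarith
  have hdW1 : 0 < dW - 1 := by linarith
  refine ⟨c₅ * b ^ (-dH / dW) * Real.exp (-c₆ * (1 / a) ^ (1 / (dW - 1))), by positivity,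
    fun f r s hr hs => ?_⟩
  have hrW : 0 < r ^ dW := by positivity
  have hs0 : 0 < s := lt_of_lt_of_le (by positivity) hs.1
  rw [oscillation, ← lintegral_const_mul' _ _ ENNReal.ofReal_ne_top]
  refine le_trans ?_ (setLIntegral_le_lintegral {z : X × X | dist z.1 z.2 < r} _)
  refine lintegral_mono_ae ?_
  filter_upwards [ae_restrict_of_ae (hest s hs0), ae_restrict_mem (measurableSet_dist_lt r)]
    with z hz hzr
  have hzr : dist z.1 z.2 < r := hzr
  rw [mul_comm]
  gcongr
  refine le_trans ?_ hz.1
  have h1 : b ^ (-dH / dW) * r ^ (-dH) ≤ s ^ (-dH / dW) := by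
    calc b ^ (-dH / dW) * r ^ (-dH) = (b * r ^ dW) ^ (-dH / dW) := by
          rw [Real.mul_rpow hb.le hrW.le, ← Real.rpow_mul hr.le]
          congr 2
          field_simp
      _ ≤ s ^ (-dH / dW) := Real.rpow_le_rpow_of_nonpos hs0 hs.2
          (div_nonpos_of_nonpos_of_nonneg (by linarith) hdW0.le)
  have h2 : (dist z.1 z.2 ^ dW / s) ^ (1 / (dW - 1)) ≤ (1 / a) ^ (1 / (dW - 1)) := by
    refine Real.rpow_le_rpow (by positivity) ?_ (by positivity)
    rw [div_le_div_iff₀ hs0 ha, one_mul]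
    calc dist z.1 z.2 ^ dW * a ≤ r ^ dW * a := by gcongr
      _ ≤ s := by linarith [hs.1]
  have h3 : Real.exp (-c₆ * (1 / a) ^ (1 / (dW - 1))) ≤
      Real.exp (-c₆ * (dist z.1 z.2 ^ dW / s) ^ (1 / (dW - 1))) := by
    apply Real.exp_le_exp.2
    nlinarith
  calc _ = c₅ * (b ^ (-dH / dW) * r ^ (-dH)) * Real.exp (-c₆ * (1 / a) ^ (1 / (dW - 1))) := by ring
    _ ≤ _ := by gcongr

variable [SFinite μ]

lemma setLIntegral_dist_lt {w : X × X → ℝ≥0∞} (hw : AEMeasurable w (μ.prod μ)) (r : ℝ) :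
    ∫⁻ z in {z : X × X | dist z.1 z.2 < r}, w z ∂(μ.prod μ) =
      ∫⁻ x, ∫⁻ y in Metric.ball x r, w (x, y) ∂μ ∂μ := by
  rw [← lintegral_indicator (measurableSet_dist_lt r),
    lintegral_prod _ (hw.indicator (measurableSet_dist_lt r))]
  refine lintegral_congr fun x => ?_
  rw [← lintegral_indicator Metric.isOpen_ball.measurableSet]
  refine lintegral_congr fun y => ?_
  simp only [indicator, mem_ofPred_eq, Metric.mem_ball, dist_comm y x]

lemma setLIntegral_dist_lt_symm {w : X × X → ℝ≥0∞} (hw : AEMeasurable w (μ.prod μ)) (r : ℝ) :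
    ∫⁻ z in {z : X × X | dist z.1 z.2 < r}, w z ∂(μ.prod μ) =
      ∫⁻ y, ∫⁻ x in Metric.ball y r, w (x, y) ∂μ ∂μ := by
  rw [← lintegral_indicator (measurableSet_dist_lt r),
    lintegral_prod_symm _ (hw.indicator (measurableSet_dist_lt r))]
  refine lintegral_congr fun x => ?_
  rw [← lintegral_indicator Metric.isOpen_ball.measurableSet]
  refine lintegral_congr fun y => ?_
  simp only [indicator, mem_ofPred_eq, Metric.mem_ball]

lemma oscillation_le_of_volume_le {f : X → ℝ} (hf : AEMeasurable f μ) {r : ℝ} {V : ℝ≥0∞}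
    (hV : ∀ x, μ (Metric.ball x r) ≤ V) :
    oscillation μ f r ≤ 2 * (V * ∫⁻ x, ENNReal.ofReal |f x| ∂μ) := by
  have hfm : AEMeasurable (fun x => ENNReal.ofReal |f x|) μ :=
    (continuous_abs.measurable.comp_aemeasurable hf).ennreal_ofReal
  calc oscillation μ f r ≤ ∫⁻ z in {z : X × X | dist z.1 z.2 < r},
        (ENNReal.ofReal |f z.1| + ENNReal.ofReal |f z.2|) ∂(μ.prod μ) := by
        refine lintegral_mono fun z => ?_
        rw [← ENNReal.ofReal_add (abs_nonneg _) (abs_nonneg _)]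
        exact ENNReal.ofReal_le_ofReal (abs_sub _ _)
    _ = (∫⁻ x, ∫⁻ y in Metric.ball x r, ENNReal.ofReal |f x| ∂μ ∂μ) +
        ∫⁻ y, ∫⁻ x in Metric.ball y r, ENNReal.ofReal |f y| ∂μ ∂μ := by
        rw [lintegral_add_left' hfm.comp_fst.restrict, setLIntegral_dist_lt hfm.comp_fst,
          setLIntegral_dist_lt_symm hfm.comp_snd]
    _ ≤ 2 * (V * ∫⁻ x, ENNReal.ofReal |f x| ∂μ) := by
        rw [two_mul, ← lintegral_const_mul'' _ hfm]
        simp only [setLIntegral_const]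
        have h : ∫⁻ x, ENNReal.ofReal |f x| * μ (Metric.ball x r) ∂μ ≤
            ∫⁻ x, V * ENNReal.ofReal |f x| ∂μ := lintegral_mono fun x => by
          rw [mul_comm]
          gcongr
          exact hV x
        exact add_le_add h h

lemma oscillation_le_ksEnergy {f : X → ℝ} (hf : AEMeasurable f μ) {lam r v : ℝ} (hr : 0 < r)
    (hpos : ∀ x, μ (Metric.ball x r) ≠ 0)
    (hV : ∀ x, μ (Metric.ball x r) ≤ ENNReal.ofReal v) :
    oscillation μ f r ≤ ENNReal.ofReal (r ^ lam * v) * ksEnergy μ lam f r := by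
  rw [oscillation, setLIntegral_dist_lt (aemeasurable_ofReal_abs_sub hf), ksEnergy,
    ← lintegral_const_mul' _ _ ENNReal.ofReal_ne_top]
  refine lintegral_mono fun x => ?_
  simp only
  rw [← lintegral_const_mul' _ _ ENNReal.ofReal_ne_top]
  refine lintegral_mono fun y => ?_
  simp only [Real.rpow_one, mul_one]
  have hrl : 0 < r ^ lam := by positivity
  have hfin : μ (Metric.ball x r) ≠ ∞ := ((hV x).trans_lt ENNReal.ofReal_lt_top).ne
  have h0 : ENNReal.ofReal (r ^ lam) * μ (Metric.ball x r) ≠ 0 :=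
    mul_ne_zero (ENNReal.ofReal_pos.2 hrl).ne' (hpos x)
  have h1 : ENNReal.ofReal (r ^ lam) * μ (Metric.ball x r) ≠ ∞ :=
    ENNReal.mul_ne_top ENNReal.ofReal_ne_top hfin
  calc ENNReal.ofReal |f x - f y| = (ENNReal.ofReal (r ^ lam) * μ (Metric.ball x r)) *
        (ENNReal.ofReal |f x - f y| / (ENNReal.ofReal (r ^ lam) * μ (Metric.ball x r))) :=
        (ENNReal.mul_div_cancel h0 h1).symm
    _ ≤ _ := by
        rw [ENNReal.ofReal_mul hrl.le]
        gcongr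
        exact hV x

lemma ksEnergy_le_oscillation {f : X → ℝ} (hf : AEMeasurable f μ) {lam r v : ℝ} (hr : 0 < r)
    (hv : 0 < v) (hV : ∀ x, ENNReal.ofReal v ≤ μ (Metric.ball x r)) :
    ksEnergy μ lam f r ≤ ENNReal.ofReal ((r ^ lam * v)⁻¹) * oscillation μ f r := by
  rw [oscillation, setLIntegral_dist_lt (aemeasurable_ofReal_abs_sub hf), ksEnergy,
    ← lintegral_const_mul' _ _ ENNReal.ofReal_ne_top]
  refine lintegral_mono fun x => ?_
  simp only
  rw [← lintegral_const_mul' _ _ ENNReal.ofReal_ne_top]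
  refine lintegral_mono fun y => ?_
  simp only [Real.rpow_one, mul_one]
  have hrl : 0 < r ^ lam := by positivity
  rw [ENNReal.ofReal_inv_of_pos (by positivity), mul_comm (_⁻¹), ← div_eq_mul_inv,
    ENNReal.ofReal_mul hrl.le]
  gcongr
  exact hV x

/-- The Korevaar–Schoen condition controls only small `r`, while heat kernel tails see every scale.
Beyond some `r₀`, the `L¹` norm times the ball volume suffices, since `1 ≤ (r / r₀)^l`. The two
summands of the constant come from these two ranges. -/
lemma IsAhlforsRegular.exists_oscillation_le {dH : ℝ}
    (hμ : IsAhlforsRegular μ dH) {lam l : ℝ} (hl : 0 < l)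
    (hlam : l ≤ lam) {f : X → ℝ} (hf : f ∈ ksSpace μ lam 1) :
    ∃ C : ℝ, 0 ≤ C ∧ ∀ r : ℝ, 0 < r → oscillation μ f r ≤ ENNReal.ofReal (C * r ^ (dH + l)) := by
  obtain ⟨c₁, c₂, hc₁, hc₂, hvol⟩ := hμ
  obtain ⟨hfL, hfks⟩ := hf
  have hfm : AEMeasurable f μ := hfL.aestronglyMeasurable.aemeasurable
  rw [ksSeminormPow_one] at hfks
  obtain ⟨D, hD1, hD2⟩ := exists_between hfks
  have hev : ∀ᶠ r in 𝓝[>] (0 : ℝ), ksEnergy μ lam f r < D := eventually_lt_of_limsup_lt hD1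
  obtain ⟨r₀, hr₀, hsub⟩ := mem_nhdsGT_iff_exists_Ioo_subset.1 hev
  have hr₀ : 0 < r₀ := hr₀
  set I := (∫⁻ x, ENNReal.ofReal |f x| ∂μ).toReal with hI
  have hI' : ∫⁻ x, ENNReal.ofReal |f x| ∂μ = ENNReal.ofReal I :=
    (ENNReal.ofReal_toReal (lintegral_ofReal_abs_lt_top hfL).ne).symm
  have hI0 : 0 ≤ I := ENNReal.toReal_nonneg
  have hD' : D = ENNReal.ofReal D.toReal := (ENNReal.ofReal_toReal hD2.ne).symm
  have hD0 : 0 ≤ D.toReal := ENNReal.toReal_nonneg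
  refine ⟨c₂ * D.toReal * r₀ ^ (lam - l) + 2 * (c₂ * I) * r₀ ^ (-l), by positivity,
    fun r hr => ?_⟩
  have hrd : 0 < r ^ dH := by positivity
  have hpos : ∀ x, μ (Metric.ball x r) ≠ 0 := fun x =>
    ((ENNReal.ofReal_pos.2 (by positivity)).trans_le (hvol x r hr.le).1).ne'
  rw [Real.rpow_add hr]
  rcases lt_or_ge r r₀ with h | h
  · have h1 : ksEnergy μ lam f r ≤ ENNReal.ofReal D.toReal := by
      rw [← hD']; exact (hsub ⟨hr, h⟩ : ksEnergy μ lam f r < D).le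
    have h2 : r ^ lam ≤ r₀ ^ (lam - l) * r ^ l := by
      have : r ^ lam = r ^ (lam - l) * r ^ l := by rw [← Real.rpow_add hr]; ring_nf
      rw [this]
      gcongr
    calc _ ≤ ENNReal.ofReal (r ^ lam * (c₂ * r ^ dH)) * ksEnergy μ lam f r :=
          oscillation_le_ksEnergy hfm hr hpos fun x => (hvol x r hr.le).2
      _ ≤ ENNReal.ofReal (r ^ lam * (c₂ * r ^ dH)) * ENNReal.ofReal D.toReal := by gcongr
      _ = ENNReal.ofReal (r ^ lam * (c₂ * r ^ dH) * D.toReal) :=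
          (ENNReal.ofReal_mul (by positivity)).symm
      _ ≤ _ := by
          apply ENNReal.ofReal_le_ofReal
          calc r ^ lam * (c₂ * r ^ dH) * D.toReal
              ≤ (r₀ ^ (lam - l) * r ^ l) * (c₂ * r ^ dH) * D.toReal := by gcongr
            _ = c₂ * D.toReal * r₀ ^ (lam - l) * (r ^ dH * r ^ l) := by ring
            _ ≤ _ := by
              gcongr
              exact le_add_of_nonneg_right (by positivity)
  · have h2 : 1 ≤ r₀ ^ (-l) * r ^ l := by
      rw [Real.rpow_neg hr₀.le, inv_mul_eq_div, one_le_div (by positivity)]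
      gcongr
    calc _ ≤ 2 * (ENNReal.ofReal (c₂ * r ^ dH) * ENNReal.ofReal I) := by
          rw [← hI']
          exact oscillation_le_of_volume_le hfm fun x => (hvol x r hr.le).2
      _ = ENNReal.ofReal (2 * (c₂ * r ^ dH * I)) := by
          rw [ENNReal.ofReal_mul zero_le_two, ENNReal.ofReal_mul (by positivity : 0 ≤ c₂ * r ^ dH),
            ENNReal.ofReal_ofNat]
      _ ≤ _ := by
          apply ENNReal.ofReal_le_ofReal
          calc 2 * (c₂ * r ^ dH * I) = 2 * (c₂ * I) * r ^ dH * 1 := by ring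
            _ ≤ 2 * (c₂ * I) * r ^ dH * (r₀ ^ (-l) * r ^ l) := by gcongr
            _ = 2 * (c₂ * I) * r₀ ^ (-l) * (r ^ dH * r ^ l) := by ring
            _ ≤ _ := by
              gcongr
              exact le_add_of_nonneg_left (by positivity)

lemma exists_exp_neg_rpow_le {c β M : ℝ} (hc : 0 < c) (hβ : 0 < β) :
    ∃ K : ℝ, 0 < K ∧ ∀ v : ℝ, 1 ≤ v → Real.exp (-c * v ^ β) ≤ K * v ^ (-M) := by
  obtain ⟨n, hn⟩ := exists_nat_ge (M / β)
  have hn' : M ≤ β * n := by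
    rw [div_le_iff₀ hβ] at hn
    linarith
  refine ⟨(n.factorial : ℝ) / c ^ n, by positivity, fun v hv => ?_⟩
  have hv0 : 0 < v := by linarith
  have h1 := Real.pow_div_factorial_le_exp (c * v ^ β) (by positivity) n
  have h2 : (c * v ^ β) ^ n = c ^ n * v ^ (β * n) := by
    rw [mul_pow, Real.rpow_mul hv0.le, Real.rpow_natCast]
  have h3 : v ^ M ≤ v ^ (β * n) := Real.rpow_le_rpow_of_exponent_le hv hn'
  have h4 : c ^ n / n.factorial * v ^ M ≤ Real.exp (c * v ^ β) := by
    refine le_trans ?_ h1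
    rw [h2, div_mul_eq_mul_div]
    gcongr
  rw [neg_mul, Real.exp_neg, Real.rpow_neg hv0.le]
  calc (Real.exp (c * v ^ β))⁻¹ ≤ (c ^ n / n.factorial * v ^ M)⁻¹ :=
        inv_anti₀ (by positivity) h4
    _ = _ := by rw [mul_inv, inv_div]

lemma exists_dyadic_exp_le {c β M : ℝ} (hc : 0 < c) (hβ : 0 < β) (hM : 0 ≤ M) :
    ∃ K : ℝ, 0 < K ∧ ∀ v : ℝ, 0 ≤ v → ∃ j : ℕ, v < 2 ^ j ∧
      Real.exp (-c * v ^ β) ≤ K * ((2 : ℝ) ^ j) ^ (-M) := by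
  obtain ⟨K, hK, hKv⟩ := exists_exp_neg_rpow_le (M := M) hc hβ
  refine ⟨1 + K * 2 ^ M, by positivity, fun v hv => ?_⟩
  have hK2 : 0 < K * 2 ^ M := by positivity
  rcases lt_or_ge v 1 with h | h
  · refine ⟨0, by simpa using h, ?_⟩
    have : Real.exp (-c * v ^ β) ≤ 1 := by
      rw [Real.exp_le_one_iff]
      have : 0 ≤ c * v ^ β := by positivity
      linarith
    simp only [pow_zero, Real.one_rpow]
    linarith
  · obtain ⟨j, hj1, hj2⟩ := exists_nat_pow_near h (one_lt_two : (1 : ℝ) < 2)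
    -- The strict bound `v < 2^(j+1)` is needed to place points in open balls; passing from `j` to
    -- `j + 1` costs the factor `2^M`.
    refine ⟨j + 1, hj2, (hKv v h).trans ?_⟩
    calc K * v ^ (-M) ≤ K * ((2 : ℝ) ^ j) ^ (-M) := by
          gcongr K * ?_
          exact Real.rpow_le_rpow_of_nonpos (by positivity) hj1 (by linarith)
      _ = K * 2 ^ M * ((2 : ℝ) ^ (j + 1)) ^ (-M) := by
          rw [pow_succ, Real.mul_rpow (by positivity) (by norm_num),
            Real.rpow_neg (by norm_num : (0 : ℝ) ≤ 2) M]
          field_simp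
      _ ≤ _ := by
          gcongr
          linarith

/-- Upper bound of the heat energy of `f` by its oscillations. -/
lemma HasSubGaussianEstimates.exists_lintegral_le {dH dW : ℝ} (hdH : 0 < dH) (hdW : 2 ≤ dW)
    {p : ℝ → X → X → ℝ} (hp : HasSubGaussianEstimates μ dH dW p) {f : X → ℝ}
    (hf : AEMeasurable f μ) {l C : ℝ} (hl : 0 < l) (hC : 0 ≤ C)
    (hosc : ∀ r : ℝ, 0 < r → oscillation μ f r ≤ ENNReal.ofReal (C * r ^ (dH + l))) :
    ∃ C' : ℝ, 0 ≤ C' ∧ ∀ s : ℝ, 0 < s →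
      ∫⁻ z, ENNReal.ofReal |f z.1 - f z.2| * ENNReal.ofReal (p s z.1 z.2) ∂(μ.prod μ) ≤
        ENNReal.ofReal (C' * s ^ (l / dW)) := by
  obtain ⟨c₃, c₄, _, _, hc₃, hc₄, _, _, hest⟩ := hp
  have hdW0 : 0 < dW := by linarith
  have hdW1 : 0 < dW - 1 := by linarith
  -- In terms of `ρ = s^(1/dW)` the sub-Gaussian exponent is `(d/ρ)^(dW/(dW-1))`. Decay of order `dH
  -- + l + 1` beats the growth `2^(j(dH + l))` of the oscillation at scale `2^j ρ` and leaves
  -- `2^(-j)` to sum.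
  obtain ⟨K, hK, hKv⟩ := exists_dyadic_exp_le (β := dW / (dW - 1)) (M := dH + l + 1) hc₄
    (by positivity) (by positivity)
  refine ⟨c₃ * K * C * 2, by positivity, fun s hs => ?_⟩
  set ρ := s ^ (1 / dW) with hρ
  have hρ0 : 0 < ρ := by positivity
  set w : X × X → ℝ≥0∞ := fun z => ENNReal.ofReal |f z.1 - f z.2| with hw
  have hwm : AEMeasurable w (μ.prod μ) := aemeasurable_ofReal_abs_sub hf
  set e : ℕ → ℝ := fun j => c₃ * s ^ (-dH / dW) * (K * ((2 : ℝ) ^ j) ^ (-(dH + l + 1))) with he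
  have hpt : ∀ᵐ z ∂(μ.prod μ), w z * ENNReal.ofReal (p s z.1 z.2) ≤
      ∑' j : ℕ, ENNReal.ofReal (e j) *
        ({z : X × X | dist z.1 z.2 < 2 ^ j * ρ}.indicator w z) := by
    filter_upwards [hest s hs] with z hz
    obtain ⟨j, hj1, hj2⟩ := hKv (dist z.1 z.2 / ρ) (by positivity)
    have hv : (dist z.1 z.2 ^ dW / s) ^ (1 / (dW - 1)) =
        (dist z.1 z.2 / ρ) ^ (dW / (dW - 1)) := by
      have h1 : ρ ^ dW = s := by
        rw [hρ, ← Real.rpow_mul hs.le, one_div_mul_cancel hdW0.ne', Real.rpow_one]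
      rw [div_eq_mul_one_div dW (dW - 1), Real.rpow_mul (by positivity),
        Real.div_rpow dist_nonneg hρ0.le, h1]
    have hmem : z ∈ {z : X × X | dist z.1 z.2 < 2 ^ j * ρ} := by
      rwa [div_lt_iff₀ hρ0] at hj1
    refine le_trans ?_ (ENNReal.le_tsum j)
    rw [indicator_of_mem hmem, mul_comm]
    gcongr
    refine hz.2.trans ?_
    rw [hv]
    simp only [he]
    gcongr
  have hterm : ∀ j : ℕ, ENNReal.ofReal (e j) * oscillation μ f (2 ^ j * ρ) ≤
      ENNReal.ofReal (c₃ * K * C * s ^ (l / dW) * (1 / 2) ^ j) := by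
    intro j
    have he0 : 0 ≤ e j := by positivity
    calc _ ≤ ENNReal.ofReal (e j) * ENNReal.ofReal (C * (2 ^ j * ρ) ^ (dH + l)) := by
          gcongr
          exact hosc _ (by positivity)
      _ = ENNReal.ofReal (e j * (C * (2 ^ j * ρ) ^ (dH + l))) := (ENNReal.ofReal_mul he0).symm
      _ = _ := by
          congr 1
          have h1 : (2 ^ j * ρ) ^ (dH + l) = (2 ^ j : ℝ) ^ (dH + l) * (s ^ (dH / dW) * s ^ (l / dW)) := by
            rw [Real.mul_rpow (by positivity) hρ0.le, hρ, ← Real.rpow_mul hs.le,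
              ← Real.rpow_add hs]
            congr 2
            ring
          have h2 : ((2 : ℝ) ^ j) ^ (-(dH + l + 1)) = ((2 : ℝ) ^ j) ^ (-(dH + l)) * (1 / 2) ^ j := by
            rw [show -(dH + l + 1) = -(dH + l) + -1 by ring, Real.rpow_add (by positivity),
              Real.rpow_neg_one, one_div, inv_pow]
          have h3 : s ^ (-dH / dW) * s ^ (dH / dW) = 1 := by
            rw [← Real.rpow_add hs, neg_div, neg_add_cancel, Real.rpow_zero]
          have h4 : ((2 : ℝ) ^ j) ^ (-(dH + l)) * ((2 : ℝ) ^ j) ^ (dH + l) = 1 := by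
            rw [← Real.rpow_add (by positivity), neg_add_cancel, Real.rpow_zero]
          simp only [he]
          rw [h1, h2]
          calc _ = c₃ * K * C * s ^ (l / dW) * (1 / 2) ^ j *
                (s ^ (-dH / dW) * s ^ (dH / dW)) *
                (((2 : ℝ) ^ j) ^ (-(dH + l)) * ((2 : ℝ) ^ j) ^ (dH + l)) := by ring
            _ = _ := by rw [h3, h4, mul_one, mul_one]
  calc _ ≤ ∫⁻ z, ∑' j : ℕ, ENNReal.ofReal (e j) *
        ({z : X × X | dist z.1 z.2 < 2 ^ j * ρ}.indicator w z) ∂(μ.prod μ) := lintegral_mono_ae hpt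
    _ = ∑' j : ℕ, ENNReal.ofReal (e j) * oscillation μ f (2 ^ j * ρ) := by
        rw [lintegral_tsum fun j => (hwm.indicator (measurableSet_dist_lt _)).const_mul _]
        congr 1
        ext j
        rw [lintegral_const_mul' _ _ ENNReal.ofReal_ne_top,
          lintegral_indicator (measurableSet_dist_lt _), oscillation]
    _ ≤ ∑' j : ℕ, ENNReal.ofReal (c₃ * K * C * s ^ (l / dW) * (1 / 2) ^ j) :=
        ENNReal.tsum_le_tsum hterm
    _ = ENNReal.ofReal (c₃ * K * C * 2 * s ^ (l / dW)) := by
        rw [← ENNReal.ofReal_tsum_of_nonneg (fun j => by positivity)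
          (summable_geometric_two.mul_left _), tsum_mul_left, tsum_geometric_two]
        ring_nf

end Oscillation
-- Besov spaces of the subordinated kernel and their critical exponent.
section CriticalExponent

lemma besovSeminorm_one {X : Type*} [MeasurableSpace X] {μ : Measure X} [SFinite μ]
    {q : ℝ → X → X → ℝ} (hq : ∀ t : ℝ, 0 < t → Measurable (Function.uncurry (q t)))
    (α : ℝ) {f : X → ℝ} (hf : AEMeasurable f μ) :
    besovSeminorm μ q 1 α f = ⨆ (t : ℝ) (_ : 0 < t), ENNReal.ofReal (t ^ (-α)) *
      ∫⁻ z, ENNReal.ofReal |f z.1 - f z.2| * ENNReal.ofReal (q t z.1 z.2) ∂(μ.prod μ) := by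
  refine iSup_congr fun t => iSup_congr fun ht => ?_
  have hm : AEMeasurable (fun z : X × X =>
      ENNReal.ofReal |f z.1 - f z.2| * ENNReal.ofReal (q t z.1 z.2)) (μ.prod μ) :=
    (aemeasurable_ofReal_abs_sub hf).mul (hq t ht).ennreal_ofReal.aemeasurable
  rw [lintegral_prod_symm _ hm]
  simp only [Real.rpow_one, div_one, ENNReal.rpow_one]

variable {X : Type*} [MetricSpace X] [ProperSpace X] [MeasurableSpace X] [BorelSpace X]
  {μ : Measure X} [μ.Regular] [μ.IsOpenPosMeasure]
  {E : DirichletForm μ} {P : ℝ → Lp ℝ 2 μ →L[ℝ] Lp ℝ 2 μ} {p q : ℝ → X → X → ℝ}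
  {dH dW δ : ℝ} {η : ℝ → ℝ → ℝ}

/-- Functions with oscillation of order `dH + l`, `l < δ dW`, lie in the Besov space of exponent
`l / (δ dW)`. -/
lemma mem_besovSpace_of_oscillation_le (hdH : 0 < dH) (hdW : 2 ≤ dW) (hδ : 0 < δ)
    (hP : E.IsHeatSemigroup P) (hp : IsHeatKernel (fun t f => P t f) p)
    (hpcont : ∀ t : ℝ, 0 < t → Continuous (Function.uncurry (p t)))
    (hHKE : HasSubGaussianEstimates μ dH dW p) (hη : IsSubordinatorDensity δ η)
    (hq : IsHeatKernel (subordinate η P) q) {f : X → ℝ} (hf : MemLp f (ENNReal.ofReal 1) μ)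
    {l C : ℝ} (hl : 0 < l) (hlδ : l < δ * dW) (hC : 0 ≤ C)
    (hosc : ∀ r : ℝ, 0 < r → oscillation μ f r ≤ ENNReal.ofReal (C * r ^ (dH + l))) :
    f ∈ besovSpace μ q 1 (l / (δ * dW)) := by
  have hdW0 : 0 < dW := by linarith
  have hfm : AEMeasurable f μ := hf.aestronglyMeasurable.aemeasurable
  obtain ⟨C', hC', hupper⟩ := hHKE.exists_lintegral_le hdH hdW hfm hl hC hosc
  obtain ⟨D, hD, hmom⟩ := hη.moment_le hδ (γ := l / dW) (by positivity)
    (by rwa [div_lt_iff₀ hdW0])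
  refine ⟨hf, ?_⟩
  rw [besovSeminorm_one hq.measurable _ hfm]
  refine lt_of_le_of_lt (iSup₂_le fun t ht => ?_)
    (ENNReal.mul_lt_top (ENNReal.ofReal_lt_top (r := C')) hD)
  rw [lintegral_mul_subordinate_kernel hP hp hpcont hη hq ht (aemeasurable_ofReal_abs_sub hfm)]
  calc _ ≤ ENNReal.ofReal (t ^ (-(l / (δ * dW)))) * ∫⁻ s in Ioi (0 : ℝ),
        ENNReal.ofReal C' * (ENNReal.ofReal (η t s) * ENNReal.ofReal (s ^ (l / dW))) := by
        refine mul_le_mul' le_rfl (setLIntegral_mono' measurableSet_Ioi fun s hs => ?_)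
        calc _ ≤ ENNReal.ofReal (η t s) * ENNReal.ofReal (C' * s ^ (l / dW)) := by
              gcongr
              exact hupper s hs
          _ = _ := by
              rw [ENNReal.ofReal_mul hC']
              ring
    _ ≤ ENNReal.ofReal (t ^ (-(l / (δ * dW)))) *
        (ENNReal.ofReal C' * (D * ENNReal.ofReal (t ^ (l / dW / δ)))) := by
        rw [lintegral_const_mul' _ _ ENNReal.ofReal_ne_top]
        gcongr
        exact hmom t ht
    _ = ENNReal.ofReal C' * D *
        ENNReal.ofReal (t ^ (-(l / (δ * dW))) * t ^ (l / dW / δ)) := by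
        rw [ENNReal.ofReal_mul (by positivity)]
        ring
    _ = _ := by
        have : l / dW / δ = l / (δ * dW) := by rw [div_div, mul_comm]
        rw [this, ← Real.rpow_add ht, neg_add_cancel, Real.rpow_zero, ENNReal.ofReal_one, mul_one]

/-- The Besov seminorm controls the oscillations at all scales `r` with `t ≤ r ^ (δ dW)`. -/
lemma exists_oscillation_le_of_mem_besovSpace (hdH : 0 < dH) (hdW : 2 ≤ dW) (hδ : 0 < δ)
    (hδ1 : δ < 1) (hP : E.IsHeatSemigroup P) (hp : IsHeatKernel (fun t f => P t f) p)
    (hpcont : ∀ t : ℝ, 0 < t → Continuous (Function.uncurry (p t)))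
    (hHKE : HasSubGaussianEstimates μ dH dW p) (hη : IsSubordinatorDensity δ η)
    (hq : IsHeatKernel (subordinate η P) q) {f : X → ℝ} {α : ℝ} (hf : f ∈ besovSpace μ q 1 α) :
    ∃ C : ℝ, 0 ≤ C ∧ ∀ r t : ℝ, 0 < r → 0 < t → t ≤ r ^ (δ * dW) →
      oscillation μ f r ≤ ENNReal.ofReal (C * r ^ (dH + δ * dW) * t ^ (α - 1)) := by
  have hfm : AEMeasurable f μ := hf.1.aestronglyMeasurable.aemeasurable
  obtain ⟨a, b, c, ha, hb, hc, hmass⟩ := hη.le_mass hδ hδ1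
  obtain ⟨c', hc', hlower⟩ := hHKE.exists_le_lintegral hdH hdW ha hb
  set N := (besovSeminorm μ q 1 α f).toReal with hN
  have hN' : besovSeminorm μ q 1 α f = ENNReal.ofReal N := (ENNReal.ofReal_toReal hf.2.ne).symm
  have hN0 : 0 ≤ N := ENNReal.toReal_nonneg
  refine ⟨N / (c * c'), by positivity, fun r t hr ht htr => ?_⟩
  have hrW : 0 < r ^ dW := by positivity
  have htr' : t ≤ (r ^ dW) ^ δ := by
    rwa [← Real.rpow_mul hr.le, mul_comm dW δ]
  have h1 : ENNReal.ofReal (t ^ (-α)) * ∫⁻ z, ENNReal.ofReal |f z.1 - f z.2| *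
      ENNReal.ofReal (q t z.1 z.2) ∂(μ.prod μ) ≤ ENNReal.ofReal N := by
    rw [← hN', besovSeminorm_one hq.measurable _ hfm]
    exact le_iSup₂ (f := fun (t : ℝ) (_ : 0 < t) => ENNReal.ofReal (t ^ (-α)) *
      ∫⁻ z, ENNReal.ofReal |f z.1 - f z.2| * ENNReal.ofReal (q t z.1 z.2) ∂(μ.prod μ)) t ht
  rw [lintegral_mul_subordinate_kernel hP hp hpcont hη hq ht
    (aemeasurable_ofReal_abs_sub hfm)] at h1
  -- The factors are the Besov weight, the mass of `η_t` in the window around `r^dW`, and the lower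
  -- heat kernel bound at those times.
  set K := t ^ (-α) * (c * (t * (r ^ dW) ^ (-δ)) * (c' * r ^ (-dH))) with hK
  have hK0 : 0 < K := by positivity
  have h2 : ENNReal.ofReal K * oscillation μ f r ≤ ENNReal.ofReal N := by
    refine le_trans ?_ h1
    rw [hK, ENNReal.ofReal_mul (by positivity), ENNReal.ofReal_mul (by positivity), mul_assoc,
      mul_assoc]
    gcongr
    calc _ ≤ (∫⁻ s in Icc (a * r ^ dW) (b * r ^ dW), ENNReal.ofReal (η t s)) *
          (ENNReal.ofReal (c' * r ^ (-dH)) * oscillation μ f r) := by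
          gcongr
          exact hmass (r ^ dW) t hrW ht htr'
      _ = ∫⁻ s in Icc (a * r ^ dW) (b * r ^ dW), ENNReal.ofReal (η t s) *
          (ENNReal.ofReal (c' * r ^ (-dH)) * oscillation μ f r) := by
          rw [lintegral_mul_const'']
          refine AEMeasurable.ennreal_ofReal ?_
          exact ((hη.integrableOn_self ht).mono_set fun s hs =>
            lt_of_lt_of_le (by positivity) hs.1).aestronglyMeasurable.aemeasurable
      _ ≤ ∫⁻ s in Icc (a * r ^ dW) (b * r ^ dW), ENNReal.ofReal (η t s) *
          ∫⁻ z, ENNReal.ofReal |f z.1 - f z.2| * ENNReal.ofReal (p s z.1 z.2) ∂(μ.prod μ) := by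
          refine setLIntegral_mono' measurableSet_Icc fun s hs => ?_
          gcongr
          exact hlower f r s hr hs
      _ ≤ _ := lintegral_mono_set fun s hs => lt_of_lt_of_le (by positivity) hs.1
  have h3 : oscillation μ f r ≤ ENNReal.ofReal N / ENNReal.ofReal K := by
    rw [ENNReal.le_div_iff_mul_le (Or.inl (ENNReal.ofReal_pos.2 hK0).ne')
      (Or.inl ENNReal.ofReal_ne_top), mul_comm]
    exact h2
  refine h3.trans_eq ?_
  rw [← ENNReal.ofReal_div_of_pos hK0]
  congr 1
  have e1 : (r ^ dW) ^ (-δ) = (r ^ (δ * dW))⁻¹ := by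
    rw [← Real.rpow_mul hr.le, ← Real.rpow_neg hr.le]
    ring_nf
  rw [hK, e1, Real.rpow_neg ht.le, Real.rpow_neg hr.le, Real.rpow_add hr, Real.rpow_sub ht,
    Real.rpow_one]
  field_simp

/-- If `α > 1`, the bound `C r^(dH + δ dW) t^(α - 1)` tends to zero as `t → 0` with `r` fixed, so
all oscillations vanish. -/
lemma le_one_of_mem_besovSpace (hdH : 0 < dH) (hdW : 2 ≤ dW) (hδ : 0 < δ)
    (hδ1 : δ < 1) (hP : E.IsHeatSemigroup P) (hp : IsHeatKernel (fun t f => P t f) p)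
    (hpcont : ∀ t : ℝ, 0 < t → Continuous (Function.uncurry (p t)))
    (hHKE : HasSubGaussianEstimates μ dH dW p) (hη : IsSubordinatorDensity δ η)
    (hq : IsHeatKernel (subordinate η P) q) {f : X → ℝ} {α : ℝ} (hf : f ∈ besovSpace μ q 1 α)
    (hnc : ¬ IsConstant μ f) : α ≤ 1 := by
  by_contra! hα
  refine hnc (isConstant_of_oscillation_eq_zero hf.1.aestronglyMeasurable.aemeasurable
    fun r hr => ?_)
  obtain ⟨C, -, hosc⟩ := exists_oscillation_le_of_mem_besovSpace hdH hdW hδ hδ1 hP hp hpcont hHKE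
    hη hq hf
  have hlim : Tendsto (fun t : ℝ => ENNReal.ofReal (C * r ^ (dH + δ * dW) * t ^ (α - 1)))
      (𝓝[>] 0) (𝓝 0) := by
    have h1 : Tendsto (fun t : ℝ => t ^ (α - 1)) (𝓝[>] 0) (𝓝 ((0 : ℝ) ^ (α - 1))) :=
      (Real.continuousAt_rpow_const 0 (α - 1) (Or.inr (by linarith))).tendsto.mono_left
        nhdsWithin_le_nhds
    rw [Real.zero_rpow (by linarith)] at h1
    simpa using ENNReal.tendsto_ofReal (h1.const_mul (C * r ^ (dH + δ * dW)))
  refine le_antisymm (ge_of_tendsto hlim ?_) zero_le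
  filter_upwards [Ioc_mem_nhdsGT (show (0 : ℝ) < r ^ (δ * dW) by positivity)] with t ht
  exact hosc r t hr ht.1 ht.2

/-- At the largest admissible time `t = r^(δ dW)` the oscillation bound becomes `C r^(dH + α δ dW)`,
and dividing by the ball volume removes `r^dH`. -/
lemma mem_ksSpace_of_mem_besovSpace (hμ : IsAhlforsRegular μ dH) (hdH : 0 < dH) (hdW : 2 ≤ dW)
    (hδ : 0 < δ) (hδ1 : δ < 1) (hP : E.IsHeatSemigroup P) (hp : IsHeatKernel (fun t f => P t f) p)
    (hpcont : ∀ t : ℝ, 0 < t → Continuous (Function.uncurry (p t)))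
    (hHKE : HasSubGaussianEstimates μ dH dW p) (hη : IsSubordinatorDensity δ η)
    (hq : IsHeatKernel (subordinate η P) q) {f : X → ℝ} {α : ℝ} (hf : f ∈ besovSpace μ q 1 α) :
    f ∈ ksSpace μ (α * (δ * dW)) 1 := by
  obtain ⟨c₁, c₂, hc₁, hc₂, hvol⟩ := hμ
  obtain ⟨C, hC, hosc⟩ := exists_oscillation_le_of_mem_besovSpace hdH hdW hδ hδ1 hP hp hpcont hHKE
    hη hq hf
  refine ⟨hf.1, ?_⟩
  rw [ksSeminormPow_one]
  refine lt_of_le_of_lt (limsup_le_of_le (by isBoundedDefault)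
    (a := ENNReal.ofReal (C / c₁)) ?_) ENNReal.ofReal_lt_top
  filter_upwards [self_mem_nhdsWithin] with r hr
  have hr : 0 < r := hr
  have hrd : 0 < r ^ (α * (δ * dW)) * (c₁ * r ^ dH) := by positivity
  calc _ ≤ ENNReal.ofReal ((r ^ (α * (δ * dW)) * (c₁ * r ^ dH))⁻¹) * oscillation μ f r :=
        ksEnergy_le_oscillation hf.1.aestronglyMeasurable.aemeasurable hr (by positivity)
          fun x => (hvol x r hr.le).1
    _ ≤ ENNReal.ofReal ((r ^ (α * (δ * dW)) * (c₁ * r ^ dH))⁻¹) *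
        ENNReal.ofReal (C * r ^ (dH + δ * dW) * (r ^ (δ * dW)) ^ (α - 1)) := by
        gcongr
        exact hosc r _ hr (by positivity) le_rfl
    _ = ENNReal.ofReal (C / c₁) := by
        rw [← ENNReal.ofReal_mul (by positivity)]
        congr 1
        rw [Real.rpow_sub (by positivity), Real.rpow_one, ← Real.rpow_mul hr.le,
          Real.rpow_add hr, mul_comm α]
        field_simp

/-- The `L¹` critical exponent of the subordinated semigroup in terms of the Korevaar–Schoen
critical exponent `L`. -/
lemma isL1CriticalExponent_min (hμ : IsAhlforsRegular μ dH) (hdH : 0 < dH) (hdW : 2 ≤ dW)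
    (hδ : 0 < δ) (hδ1 : δ < 1) (hP : E.IsHeatSemigroup P) (hp : IsHeatKernel (fun t f => P t f) p)
    (hpcont : ∀ t : ℝ, 0 < t → Continuous (Function.uncurry (p t)))
    (hHKE : HasSubGaussianEstimates μ dH dW p) (hη : IsSubordinatorDensity δ η)
    (hq : IsHeatKernel (subordinate η P) q) {L : ℝ} (hL : IsLUB (ksExponents μ) L) (hL0 : 0 < L) :
    IsL1CriticalExponent μ q (min L (δ * dW) / (δ * dW)) := by
  have hdW0 : 0 < dW := by linarith
  have hδW : 0 < δ * dW := by positivity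
  refine ⟨?_, fun B hB => ?_⟩
  · rintro α ⟨hα, f, hf, hnc⟩
    rw [le_div_iff₀ hδW, le_min_iff]
    refine ⟨hL.1 ⟨by positivity, f, mem_ksSpace_of_mem_besovSpace hμ hdH hdW hδ hδ1 hP hp hpcont
      hHKE hη hq hf, hnc⟩, ?_⟩
    have := le_one_of_mem_besovSpace hdH hdW hδ hδ1 hP hp hpcont hHKE hη hq hf hnc
    nlinarith
  · rw [div_le_iff₀ hδW]
    refine le_of_forall_lt_imp_le_of_dense fun l hl => ?_
    have hmin : 0 < min L (δ * dW) := lt_min hL0 hδW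
    -- Besov exponents must be positive but `l` need not be; `m` is positive, at least `l`, and
    -- still below the minimum.
    set m := max l (min L (δ * dW) / 2)
    have hm0 : 0 < m := lt_max_of_lt_right (by linarith)
    obtain ⟨hmL, hmδ⟩ := lt_min_iff.1 (max_lt hl (half_lt_self hmin) : m < min L (δ * dW))
    obtain ⟨lam, ⟨-, f, hf, hnc⟩, hmlam⟩ := (lt_isLUB_iff hL).1 hmL
    obtain ⟨C, hC, hosc⟩ := hμ.exists_oscillation_le hm0 hmlam.le hf
    have hmem := mem_besovSpace_of_oscillation_le hdH hdW hδ hP hp hpcont hHKE hη hq hf.1 hm0 hmδ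
      hC hosc
    have hB' : m / (δ * dW) ≤ B := hB ⟨by positivity, f, hmem, hnc⟩
    exact (le_max_left _ _).trans ((div_le_iff₀ hδW).1 hB')

end CriticalExponent
end NonlocalBV

theorem theoremL1 {X : Type*} [MetricSpace X] [ProperSpace X] [MeasurableSpace X] [BorelSpace X]
    (μ : Measure X) [μ.Regular] [μ.IsOpenPosMeasure]
    (dH dW κ δ : ℝ) (hdH : 0 < dH) (hdW : 2 ≤ dW) (hκ : 0 < κ) (hκW : κ < dW)
    (hδ : 0 < δ) (hδ1 : δ < 1)
    (hAhlfors : NonlocalBV.IsAhlforsRegular μ dH)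
    (E : NonlocalBV.DirichletForm μ) (hreg : E.IsRegular) (hloc : E.IsStronglyLocal)
    (P : ℝ → Lp ℝ 2 μ →L[ℝ] Lp ℝ 2 μ) (hP : E.IsHeatSemigroup P)
    (p : ℝ → X → X → ℝ) (hp : NonlocalBV.IsHeatKernel (fun t f => P t f) p)
    (hpcont : ∀ t : ℝ, 0 < t → Continuous (Function.uncurry (p t)))
    (hHKE : NonlocalBV.HasSubGaussianEstimates μ dH dW p)
    (hBE : NonlocalBV.WeakBakryEmery μ dW κ p)
    (η : ℝ → ℝ → ℝ) (hη : NonlocalBV.IsSubordinatorDensity δ η)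
    (q : ℝ → X → X → ℝ) (hq : NonlocalBV.IsHeatKernel (NonlocalBV.subordinate η P) q) :
    (δ ≤ 1 - κ / dW → NonlocalBV.IsL1CriticalExponent μ q 1) ∧
      (1 - κ / dW < δ → NonlocalBV.IsL1CriticalExponent μ q (1 / δ * (1 - κ / dW))) := by
  have hdW0 : 0 < dW := by linarith
  have hδW : 0 < δ * dW := by positivity
  -- Here `L = dW - κ`; comparing `δ` with `1 - κ / dW` decides which term is the minimum.
  have hmain := NonlocalBV.isL1CriticalExponent_min hAhlfors hdH hdW hδ hδ1 hP hp hpcont hHKE hη hq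
    hBE.critical (by linarith)
  have hL : (1 - κ / dW) * dW = dW - κ := by field_simp
  refine ⟨fun h => ?_, fun h => ?_⟩
  · have h1 : δ * dW ≤ dW - κ := by
      rw [← hL]
      gcongr
    rwa [min_eq_right h1, div_self hδW.ne'] at hmain
  · have h1 : dW - κ ≤ δ * dW := by
      rw [← hL]
      gcongr
    rw [min_eq_left h1] at hmain
    convert hmain using 1
    field_simp
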